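/- Let $V$ be a finite-dimensional real Euclidean space and let $\mathcal{A}$ be a (central) hyperplane arrangement in $V$, that is, a finite set of linear hyperplanes of $V$. The regions of $\mathcal{A}$ are the closures of the connected components of $V \setminus \bigcup_{H\in\mathcal{A}} H$; a wall of a region $R$ is a hyperplane $H\in\mathcal{A}$ with $\dim(H\cap R)=\dim V-1$; $\mathcal{A}$ is simplicial if for every region the normal vectors of its walls are linearly independent. The faces of $\mathcal{A}$ are the intersections of nonempty families of regions. Fix a base region $B$. For a region $R$ let $S(R)$ be the set of hyperplanes of $\mathcal{A}$ that separate $B$ from $R$, and order the regions by $R\le_B R'$ if and only if $S(R)\subseteq S(R')$. For every face $F$ the set of regions containing $F$ is an interval $[m_F,M_F]$ of this poset of regions, and the facial weak order on the set of faces is defined by $$F\le G \iff m_F\le_B m_G \text{ and } M_F\le_B M_G .$$ **Theorem.** If $\mathcal{A}$ is simplicial, then for every base region $B$ the facial weak order on the faces of $\mathcal{A}$ is a semidistributive lattice: it is a lattice, and for all faces $x,y,z$, $$x\vee y=x\vee z \implies x\vee y=x\vee(y\wedge z), \qquad x\wedge y=x\wedge z \implies x\wedge y=x\wedge(y\vee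 z).$$ -/

import Mathlib

open scoped InnerProductSpace

/-- The vector `e` is a (nonzero) normal vector of the linear subspace `H`:
`H = {v | ⟪e, v⟫ = 0}`. -/
def IsNormalVector {V : Type*} [NormedAddCommGroup V] [InnerProductSpace ℝ V]
    (e : V) (H : Submodule ℝ V) : Prop :=
  e ≠ 0 ∧ ∀ v : V, v ∈ H ↔ ⟪e, v⟫_ℝ = 0

/-- A central hyperplane arrangement: a finite set of linear hyperplanes of `V`. -/
structure HyperplaneArrangement (V : Type*) [NormedAddCommGroup V] [InnerProductSpace ℝ V] where
  /-- the hyperplanes of the arrangement -/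
  hyperplanes : Finset (Submodule ℝ V)
  /-- each of them is a linear hyperplane -/
  exists_normal : ∀ H ∈ hyperplanes, ∃ e : V, IsNormalVector e H

namespace HyperplaneArrangement

variable {V : Type*} [NormedAddCommGroup V] [InnerProductSpace ℝ V]

/-- The complement in `V` of the union of the hyperplanes. -/
def complement (A : HyperplaneArrangement V) : Set V :=
  {v : V | ∀ H ∈ A.hyperplanes, v ∉ H}

/-- The regions are the closures of the connected components of the complement. -/
def IsRegion (A : HyperplaneArrangement V) (R : Set V) : Prop :=
  ∃ x ∈ A.complement, R = closure (connectedComponentIn A.complement x)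

/-- The set of regions, as a type. -/
def Region (A : HyperplaneArrangement V) : Type _ := {R : Set V // A.IsRegion R}

/-- The faces are the intersections of nonempty families of regions. -/
def IsFace (A : HyperplaneArrangement V) (F : Set V) : Prop :=
  ∃ 𝓡 : Set (Set V), 𝓡.Nonempty ∧ (∀ R ∈ 𝓡, A.IsRegion R) ∧ F = ⋂₀ 𝓡

/-- The set of faces, as a type. -/
def Face (A : HyperplaneArrangement V) : Type _ := {F : Set V // A.IsFace F}

/-- `H` is a wall of the region `R`: `H` belongs to the arrangement and
`dim (H ∩ R) = dim V - 1`. The dimension of a convex set is that of its affine span. -/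
def IsWall (A : HyperplaneArrangement V) (R : A.Region) (H : Submodule ℝ V) : Prop :=
  H ∈ A.hyperplanes ∧
    Module.finrank ℝ (vectorSpan ℝ ((H : Set V) ∩ R.1)) + 1 = Module.finrank ℝ V

/-- A region is simplicial if the normal vectors of its walls are linearly independent
(this does not depend on the normal vectors that one chooses). -/
def IsSimplicialRegion (A : HyperplaneArrangement V) (R : A.Region) : Prop :=
  ∃ e : {H : Submodule ℝ V // A.IsWall R H} → V,
    (∀ H, IsNormalVector (e H) H.1) ∧ LinearIndependent ℝ e

/-- An arrangement is simplicial if all its regions are. -/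
def IsSimplicial (A : HyperplaneArrangement V) : Prop :=
  ∀ R : A.Region, A.IsSimplicialRegion R

/-- The hyperplane `H` separates `R` from `R'`: the two sets lie on opposite closed sides
of `H`. -/
def Separates (H : Submodule ℝ V) (R R' : Set V) : Prop :=
  ∃ e : V, IsNormalVector e H ∧ (∀ v ∈ R, 0 ≤ ⟪e, v⟫_ℝ) ∧ (∀ v ∈ R', ⟪e, v⟫_ℝ ≤ 0)

/-- The separation set `S(R, R')` of two regions. -/
def separationSet (A : HyperplaneArrangement V) (R R' : A.Region) : Set (Submodule ℝ V) :=
  {H | H ∈ A.hyperplanes ∧ Separates H R.1 R'.1}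

/-- The order of the poset of regions with base region `B`: `S(B, R) ⊆ S(B, R')`. -/
def RegionLE (A : HyperplaneArrangement V) (B R R' : A.Region) : Prop :=
  A.separationSet B R ⊆ A.separationSet B R'

/-- `[m, M]` is the facial interval of the face `F`: the regions that contain `F` are exactly
those in the interval from `m` to `M` of the poset of regions with base region `B`. -/
def IsFacialInterval (A : HyperplaneArrangement V) (B : A.Region) (F : A.Face)
    (m M : A.Region) : Prop :=
  A.RegionLE B m M ∧
    ∀ R : A.Region, F.1 ⊆ R.1 ↔ A.RegionLE B m R ∧ A.RegionLE B R M

/-- The facial weak order: `F ≤ G` if and only if `m_F ≤ m_G` and `M_F ≤ M_G` in the poset of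
regions, where `[m_F, M_F]` and `[m_G, M_G]` are the facial intervals of `F` and `G`. -/
def FacialWeakLE (A : HyperplaneArrangement V) (B : A.Region) (F G : A.Face) : Prop :=
  ∃ mF MF mG MG : A.Region, A.IsFacialInterval B F mF MF ∧ A.IsFacialInterval B G mG MG ∧
    A.RegionLE B mF mG ∧ A.RegionLE B MF MG

end HyperplaneArrangement

/-- A lattice is join-semidistributive if `x ⊔ y = x ⊔ z` implies `x ⊔ y = x ⊔ (y ⊓ z)`. -/
def IsJoinSemidistributive (L : Type*) [Lattice L] : Prop :=
  ∀ x y z : L, x ⊔ y = x ⊔ z → x ⊔ y = x ⊔ (y ⊓ z)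

/-- A lattice is meet-semidistributive if `x ⊓ y = x ⊓ z` implies `x ⊓ y = x ⊓ (y ⊔ z)`. -/
def IsMeetSemidistributive (L : Type*) [Lattice L] : Prop :=
  ∀ x y z : L, x ⊓ y = x ⊓ z → x ⊓ y = x ⊓ (y ⊔ z)

/-- A lattice is semidistributive if it is both join- and meet-semidistributive. -/
def IsSemidistributive (L : Type*) [Lattice L] : Prop :=
  IsJoinSemidistributive L ∧ IsMeetSemidistributive L

/-!
The facial weak order is the componentwise order of sign vectors. Choose a normal vector of every
hyperplane, pointing away from the base region, so that the sign vector of `B` is `-1`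
everywhere. Faces correspond to sign vectors of points (`isFace_iff`, `closedFace_eq_iff`); the
facial interval of a face is obtained by replacing all zeros by `-1` and by `1`
(`isFacialInterval_iff`), so that `F ≤ G` means that the sign vector of `F` is below that of `G`
in every entry (`facialWeakLE_iff`). The antipodal map reverses this order.

For a point `v`, let `R` be the region containing `v` that is closest to `B`. As `R` is
simplicial, its walls give independent linear coordinates (`SimplicialChart`) in which, up to
sign, all forms of the arrangement have nonnegative coefficients. An up wall of `R` is one on
whose negative side `R` lies; at `v` its sign is `-1` or `0`. For a set `T` of up walls, moving
`v` along the dual vectors raises the signs at `T` by one, and the resulting sign vector is the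
least one above `v` with these signs raised (`SimplicialChart.raise_le_iff`). The steps that
raise one sign generate the order (`SimplicialChart.le_of_forall_not_raised`), and two steps out
of `v` have the join that raises both signs. By the local criterion of Björner, Edelman and
Ziegler (`exists_isLUB_of_step`) all joins exist, and by the antipodal map so do all meets.

Semidistributivity has a similar local criterion (`isMeetSemidistributive_of_step`): if `u` lies
below the join of two steps out of `v` but not below `v`, then some `t ≤ u` lies below one of the
two steps but not below `v`. A minimal `t ≤ u` not below `v` will do: the analysis of the steps
down from `t` shows that exactly one sign is greater at `t` than at `v`, and only by one
(`exists_le_sign_jump`), and in the chart at `v` such a `t` lies below one of the steps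
(`SimplicialChart.le_raise_or_le_raise`). Join-semidistributivity follows by the antipodal map.
-/

/-! ### Local criteria for lattices and semidistributivity -/

/-- Local criterion for the existence of joins: it suffices that two steps `p → x`, `p → y`
out of a common element have a join, for a relation of steps that generates the order. -/
theorem exists_isLUB_of_step {P : Type*} [PartialOrder P] [WellFoundedGT P]
    (step : P → P → Prop) (step_lt : ∀ p q, step p q → p < q)
    (exists_step : ∀ p u, p < u → ∃ q, step p q ∧ q ≤ u)
    (isLUB_step : ∀ p x y, step p x → step p y → ∃ q, IsLUB {x, y} q)
    (p x y : P) (hx : p ≤ x) (hy : p ≤ y) : ∃ q, IsLUB {x, y} q := by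
  induction p using WellFoundedGT.induction generalizing x y with
  | ind p ih =>
    rcases hx.eq_or_lt with rfl | hx
    · exact ⟨y, by simp [hy], fun u hu => hu (by simp)⟩
    rcases hy.eq_or_lt with rfl | hy
    · exact ⟨x, by simp [hx.le], fun u hu => hu (by simp)⟩
    obtain ⟨x₁, hpx, hx₁⟩ := exists_step p x hx
    obtain ⟨y₁, hpy, hy₁⟩ := exists_step p y hy
    obtain ⟨q, hq⟩ := isLUB_step p x₁ y₁ hpx hpy
    have hx₁q : x₁ ≤ q := hq.1 (by simp)
    have hy₁q : y₁ ≤ q := hq.1 (by simp)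
    obtain ⟨r, hr⟩ := ih x₁ (step_lt _ _ hpx) x q hx₁ hx₁q
    have hxr : x ≤ r := hr.1 (by simp)
    have hqr : q ≤ r := hr.1 (by simp)
    obtain ⟨m, hm⟩ := ih y₁ (step_lt _ _ hpy) r y (hy₁q.trans hqr) hy₁
    refine ⟨m, ?_, fun u hu => hm.2 ?_⟩
    · have hrm : r ≤ m := hm.1 (by simp)
      have hym : y ≤ m := hm.1 (by simp)
      simp [hxr.trans hrm, hym]
    · have hxu : x ≤ u := hu (by simp)
      have hyu : y ≤ u := hu (by simp)
      have hqu : q ≤ u := hq.2 (by simp [hx₁.trans hxu, hy₁.trans hyu])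
      have hru : r ≤ u := hr.2 (by simp [hxu, hqu])
      simp [hru, hyu]

/-- The lattice structure of a partial order in which all pairs have a join and a meet. -/
noncomputable abbrev latticeOfIsLUBIsGLB {P : Type*} [PartialOrder P]
    (hsup : ∀ x y : P, ∃ q, IsLUB {x, y} q) (hinf : ∀ x y : P, ∃ q, IsGLB {x, y} q) :
    Lattice P where
  sup x y := (hsup x y).choose
  inf x y := (hinf x y).choose
  le_sup_left x y := (hsup x y).choose_spec.1 (by simp)
  le_sup_right x y := (hsup x y).choose_spec.1 (by simp)
  sup_le x y z hx hy := (hsup x y).choose_spec.2 (by simp [hx, hy])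
  inf_le_left x y := (hinf x y).choose_spec.1 (by simp)
  inf_le_right x y := (hinf x y).choose_spec.1 (by simp)
  le_inf x y z hx hy := (hinf y z).choose_spec.2 (by simp [hx, hy])

/-- Local criterion for meet-semidistributivity: it suffices to look at two steps `p → x`,
`p → y` out of a common element, for a relation of steps that generates the order. -/
theorem isMeetSemidistributive_of_step {P : Type*} [Lattice P] [WellFoundedGT P]
    (step : P → P → Prop) (step_lt : ∀ p q, step p q → p < q)
    (exists_step : ∀ p u, p < u → ∃ q, step p q ∧ q ≤ u)
    (hstep : ∀ p x y, step p x → step p y → ∀ u ≤ x ⊔ y, ¬ u ≤ p →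
      ∃ t ≤ u, ¬ t ≤ p ∧ (t ≤ x ∨ t ≤ y)) :
    IsMeetSemidistributive P := by
  have local_le : ∀ p x y u, step p x → step p y → u ⊓ x ≤ p → u ⊓ y ≤ p →
      u ⊓ (x ⊔ y) ≤ p := by
    intro p x y u hx hy hux huy
    by_contra hu
    obtain ⟨t, htu, htp, ht⟩ := hstep p x y hx hy _ inf_le_right hu
    have htu' : t ≤ u := htu.trans inf_le_left
    rcases ht with ht | ht
    · exact htp ((le_inf htu' ht).trans hux)
    · exact htp ((le_inf htu' ht).trans huy)
  have key : ∀ w x y z : P, w ≤ y → w ≤ z → x ⊓ y ≤ w → x ⊓ z ≤ w →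
      x ⊓ (y ⊔ z) ≤ w := by
    intro w
    induction w using WellFoundedGT.induction with
    | ind w ih =>
      intro x y z hy hz hxy hxz
      rcases hy.eq_or_lt with rfl | hy
      · rwa [sup_eq_right.2 hz]
      rcases hz.eq_or_lt with rfl | hz
      · rwa [sup_eq_left.2 hy.le]
      obtain ⟨y₁, hwy, hy₁⟩ := exists_step w y hy
      obtain ⟨z₁, hwz, hz₁⟩ := exists_step w z hz
      have hq : x ⊓ (y₁ ⊔ z₁) ≤ w := local_le w y₁ z₁ x hwy hwz
        ((inf_le_inf_left x hy₁).trans hxy) ((inf_le_inf_left x hz₁).trans hxz)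
      have hwy' := (step_lt _ _ hwy).le
      have hwz' := (step_lt _ _ hwz).le
      -- Meets with `x` do not change when the lower bound `w` is raised to `y₁` or `z₁`.
      have h₁ : x ⊓ (y ⊔ (y₁ ⊔ z₁)) ≤ y₁ := ih y₁ (step_lt _ _ hwy) x y (y₁ ⊔ z₁) hy₁
        le_sup_left (hxy.trans hwy') (hq.trans hwy')
      have h₁' : x ⊓ (y ⊔ (y₁ ⊔ z₁)) ≤ w :=
        (le_inf inf_le_left (h₁.trans hy₁)).trans hxy
      have h₂ : x ⊓ (y ⊔ (y₁ ⊔ z₁) ⊔ z) ≤ z₁ := ih z₁ (step_lt _ _ hwz) x _ z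
        (le_sup_right.trans le_sup_right) hz₁ (h₁'.trans hwz') (hxz.trans hwz')
      have h₂' : x ⊓ (y ⊔ (y₁ ⊔ z₁) ⊔ z) ≤ w :=
        (le_inf inf_le_left (h₂.trans hz₁)).trans hxz
      exact (inf_le_inf_left x (sup_le_sup_right le_sup_left z)).trans h₂'
  intro x y z h
  refine le_antisymm (inf_le_inf_left x le_sup_left) (le_inf inf_le_left ?_)
  have hle : x ⊓ (y ⊔ z) ≤ y ⊓ z :=
    key (y ⊓ z) x y z inf_le_left inf_le_right
      (le_inf inf_le_right (h.le.trans inf_le_right))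
      (le_inf (h.ge.trans inf_le_right) inf_le_right)
  exact hle.trans inf_le_left

/-- A meet-semidistributive lattice with an order-reversing bijection onto itself is
semidistributive. -/
theorem IsMeetSemidistributive.isSemidistributive {P : Type*} [Lattice P]
    (h : IsMeetSemidistributive P) (φ : P ≃o Pᵒᵈ) : IsSemidistributive P := by
  have hsup (x y : P) : OrderDual.ofDual (φ (x ⊔ y)) =
      OrderDual.ofDual (φ x) ⊓ OrderDual.ofDual (φ y) := by rw [map_sup]; rfl
  have hinf (x y : P) : OrderDual.ofDual (φ (x ⊓ y)) =
      OrderDual.ofDual (φ x) ⊔ OrderDual.ofDual (φ y) := by rw [map_inf]; rfl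
  refine ⟨fun x y z hxy => ?_, h⟩
  have := h (OrderDual.ofDual (φ x)) (OrderDual.ofDual (φ y)) (OrderDual.ofDual (φ z))
    (by rw [← hsup, ← hsup, hxy])
  rw [← hinf, ← hsup, ← hsup] at this
  exact φ.injective (OrderDual.ofDual.injective this)

/-- A semidistributive lattice structure is transported along a bijection. -/
theorem IsSemidistributive.exists_lattice_of_equiv {α P : Type*} [Lattice P]
    (h : IsSemidistributive P) (φ : α ≃ P) :
    ∃ L : Lattice α, (∀ a b, L.le a b ↔ φ a ≤ φ b) ∧ @IsSemidistributive α L := by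
  let : PartialOrder α := PartialOrder.lift φ φ.injective
  let L : Lattice α :=
    { (inferInstance : PartialOrder α) with
      sup a b := φ.symm (φ a ⊔ φ b)
      inf a b := φ.symm (φ a ⊓ φ b)
      le_sup_left a b := show φ _ ≤ φ _ by simp
      le_sup_right a b := show φ _ ≤ φ _ by simp
      sup_le a b c hac hbc := show φ _ ≤ φ _ by
        rw [φ.apply_symm_apply]; exact sup_le hac hbc
      inf_le_left a b := show φ _ ≤ φ _ by simp
      inf_le_right a b := show φ _ ≤ φ _ by simp
      le_inf a b c hab hac := show φ _ ≤ φ _ by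
        rw [φ.apply_symm_apply]; exact le_inf hab hac }
  have hsup (a b : α) : φ (a ⊔ b) = φ a ⊔ φ b := φ.apply_symm_apply _
  have hinf (a b : α) : φ (a ⊓ b) = φ a ⊓ φ b := φ.apply_symm_apply _
  refine ⟨L, fun _ _ => Iff.rfl, fun x y z hxy => ?_, fun x y z hxy => ?_⟩
  · apply φ.injective
    simp only [hsup, hinf]
    exact h.1 _ _ _ (by rw [← hsup, ← hsup, hxy])
  · apply φ.injective
    simp only [hsup, hinf]
    exact h.2 _ _ _ (by rw [← hinf, ← hinf, hxy])

/-! ### Sign vectors and simplicial charts -/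

/-- The sign vector (covector) of the point `v` with respect to the linear forms `f i`. -/
noncomputable def signVector {V ι : Type*} [AddCommGroup V] [Module ℝ V] (f : ι → V →ₗ[ℝ] ℝ)
    (v : V) : ι → SignType :=
  fun i => SignType.sign (f i v)

theorem sign_le_sign_iff_pos_nonneg {x y : ℝ} :
    SignType.sign x ≤ SignType.sign y ↔ (0 < x → 0 < y) ∧ (0 ≤ x → 0 ≤ y) := by
  rcases lt_trichotomy x 0 with hx | rfl | hx <;> rcases lt_trichotomy y 0 with hy | rfl | hy <;>
    simp [*, le_of_lt, not_le_of_gt, not_lt_of_gt]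

theorem signVector_neg {V ι : Type*} [AddCommGroup V] [Module ℝ V] (f : ι → V →ₗ[ℝ] ℝ) (v : V) :
    signVector f (-v) = -signVector f v := by
  ext i
  simp [signVector, Left.sign_neg]

/-- Local coordinates at `v` for the arrangement of the kernels of the `f i`. They come from the
region that contains `v` and, among the regions that contain `v`, is closest to the base region,
on which all `f i` are negative. The set `W` indexes walls of that region, `s i` is the sign of
`f i` on it, the forms `s k * f k` for `k ∈ W` are coordinates with dual vectors `d k`, and each
`s i * f i` is a combination of these coordinates with coefficients `c i k ≥ 0`. The number `ε`
is small with respect to the position of `v`. -/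
structure SimplicialChart {V ι : Type*} [AddCommGroup V] [Module ℝ V] (f : ι → V →ₗ[ℝ] ℝ)
    (v : V) where
  /-- walls that define the region -/
  W : Finset ι
  /-- the sign of `f i` on the region -/
  s : ι → ℝ
  /-- the coefficients of `s i * f i` in the coordinates -/
  c : ι → ι → ℝ
  /-- the vectors dual to the coordinates -/
  d : ι → V
  /-- a small positive number -/
  ε : ℝ
  s_eq : ∀ i, s i = 1 ∨ s i = -1
  c_nonneg : ∀ i, ∀ k ∈ W, 0 ≤ c i k
  expand : ∀ i u, s i * f i u = ∑ k ∈ W, c i k * (s k * f k u)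
  dual_self : ∀ k ∈ W, s k * f k (d k) = 1
  dual_of_ne : ∀ k ∈ W, ∀ l ∈ W, k ≠ l → f k (d l) = 0
  nonneg : ∀ i, 0 ≤ s i * f i v
  s_of_eq_zero : ∀ i, f i v = 0 → s i = -1
  ε_pos : 0 < ε
  ε_lt : ∀ i, ∀ k ∈ W, 0 < c i k * (s k * f k v) → ε * ∑ l ∈ W, c i l < c i k * (s k * f k v)

namespace SimplicialChart

variable {V ι : Type*} [AddCommGroup V] [Module ℝ V] {f : ι → V →ₗ[ℝ] ℝ} {v : V}

/-- The walls across which one leaves the region of the chart upwards, that is, away from the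
base region. -/
def upWalls (C : SimplicialChart f v) : Set ι := {k | k ∈ C.W ∧ C.s k = -1}

/-- The point obtained from `v` by raising the signs of the `f k`, `k ∈ T`, by one: from
negative to zero, or from zero to positive. The other coordinates are kept. -/
noncomputable def raise (C : SimplicialChart f v) (T : Finset ι) : V :=
  v - ∑ k ∈ T, (if f k v = 0 then C.ε else C.s k * f k v) • C.d k

/-- The sign of `f k` at `u` is greater than at `v`, for an up wall `k`
(where it is at most zero at `v`). -/
def Raised (_C : SimplicialChart f v) (k : ι) (u : V) : Prop :=
  (f k v = 0 → 0 < f k u) ∧ 0 ≤ f k u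

/-- The form `f i` is a combination of the coordinates that vanish at `v` and of those indexed
by `T`. -/
def Tight (C : SimplicialChart f v) (T : Finset ι) (i : ι) : Prop :=
  ∀ k ∈ C.W, C.c i k ≠ 0 → f k v = 0 ∨ k ∈ T

variable (C : SimplicialChart f v)

theorem s_mul_s (i : ι) : C.s i * C.s i = 1 := by
  rcases C.s_eq i with h | h <;> simp [h]

theorem apply_eq (i : ι) (u : V) : f i u = C.s i * (C.s i * f i u) := by
  rw [← mul_assoc, C.s_mul_s, one_mul]

theorem s_ne_zero (i : ι) : C.s i ≠ 0 := by
  rcases C.s_eq i with h | h <;> simp [h]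

theorem apply_eq_zero_of_coeff_ne_zero {i k : ι} (hi : f i v = 0) (hk : k ∈ C.W)
    (hc : C.c i k ≠ 0) : f k v = 0 := by
  have h0 := C.expand i v
  rw [hi, mul_zero, eq_comm, Finset.sum_eq_zero_iff_of_nonneg fun k hk =>
    mul_nonneg (C.c_nonneg i k hk) (C.nonneg k)] at h0
  exact (mul_eq_zero.1 ((mul_eq_zero.1 (h0 k hk)).resolve_left hc)).resolve_left (C.s_ne_zero k)

theorem nonpos_of_mem_upWalls {k : ι} (hk : k ∈ C.upWalls) : f k v ≤ 0 := by
  have := C.nonneg k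
  rw [hk.2] at this
  linarith

theorem not_raised {k : ι} (hk : k ∈ C.upWalls) : ¬ C.Raised k v := by
  rintro ⟨h₁, h₂⟩
  exact (h₁ (le_antisymm (C.nonpos_of_mem_upWalls hk) h₂)).not_ge (C.nonpos_of_mem_upWalls hk)

theorem apply_raise_of_notMem {T : Finset ι} (hT : ∀ k ∈ T, k ∈ C.upWalls) {k : ι} (hk : k ∈ C.W)
    (hkT : k ∉ T) : f k (C.raise T) = f k v := by
  have : ∑ l ∈ T, (if f l v = 0 then C.ε else C.s l * f l v) * f k (C.d l) = 0 :=
    Finset.sum_eq_zero fun l hl => by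
      rw [C.dual_of_ne k hk l (hT l hl).1 (fun h => hkT (h ▸ hl)), mul_zero]
  simp only [raise, map_sub, map_sum, map_smul, smul_eq_mul, this, sub_zero]

theorem apply_raise_of_mem {T : Finset ι} (hT : ∀ k ∈ T, k ∈ C.upWalls) {k : ι} (hkT : k ∈ T) :
    f k (C.raise T) = if f k v = 0 then C.ε else 0 := by
  have hk := hT k hkT
  have hd : f k (C.d k) = -1 := by
    have := C.dual_self k hk.1
    rw [hk.2] at this
    linarith
  have : ∑ l ∈ T, (if f l v = 0 then C.ε else C.s l * f l v) * f k (C.d l) =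
      (if f k v = 0 then C.ε else C.s k * f k v) * f k (C.d k) :=
    Finset.sum_eq_single_of_mem k hkT fun l hl hlk => by
      rw [C.dual_of_ne k hk.1 l (hT l hl).1 hlk.symm, mul_zero]
  simp only [raise, map_sub, map_sum, map_smul, smul_eq_mul, this, hd, hk.2]
  split_ifs with h <;> simp [h]

theorem raised_raise {T : Finset ι} (hT : ∀ k ∈ T, k ∈ C.upWalls) {k : ι} (hkT : k ∈ T) :
    C.Raised k (C.raise T) := by
  have hε := C.ε_pos
  rw [Raised, C.apply_raise_of_mem hT hkT]
  split_ifs with h <;> simp [h, hε, hε.le]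

theorem apply_raise_eq_zero {T : Finset ι} (hT : ∀ k ∈ T, k ∈ C.upWalls) {k : ι}
    (hkT : k ∈ T) (hk : f k v ≠ 0) : f k (C.raise T) = 0 := by
  rw [C.apply_raise_of_mem hT hkT, if_neg hk]

variable {b : V}

/-- A wall that occurs in a tight form is an up wall. -/
theorem Tight.mem_upWalls {C : SimplicialChart f v} {T : Finset ι}
    (hT : ∀ k ∈ T, k ∈ C.upWalls) {i : ι} (hi : C.Tight T i) {k : ι} (hk : k ∈ C.W)
    (hc : C.c i k ≠ 0) : k ∈ C.upWalls :=
  (hi k hk hc).elim (fun h => ⟨hk, C.s_of_eq_zero k h⟩) (hT k)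

/-- A tight form is nonpositive on the region of the chart, since it is negative at `b`. -/
theorem Tight.s_eq_neg_one {C : SimplicialChart f v} (hb : ∀ i, f i b < 0) {T : Finset ι}
    (hT : ∀ k ∈ T, k ∈ C.upWalls) {i : ι} (hi : C.Tight T i) : C.s i = -1 := by
  refine (C.s_eq i).resolve_left fun h => ?_
  have h₁ := C.expand i b
  have h₂ : 0 ≤ ∑ k ∈ C.W, C.c i k * (C.s k * f k b) := Finset.sum_nonneg fun k hk => by
    by_cases hc : C.c i k = 0
    · simp [hc]
    · rw [(hi.mem_upWalls hT hk hc).2]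
      exact mul_nonneg (C.c_nonneg i k hk) (by linarith [hb k])
  rw [h] at h₁
  linarith [hb i]

theorem Tight.apply_eq_sum {C : SimplicialChart f v} (hb : ∀ i, f i b < 0) {T : Finset ι}
    (hT : ∀ k ∈ T, k ∈ C.upWalls) {i : ι} (hi : C.Tight T i) (u : V) :
    f i u = ∑ k ∈ C.W, C.c i k * f k u := by
  have h := C.expand i u
  have h₂ : ∑ k ∈ C.W, C.c i k * (C.s k * f k u) = -∑ k ∈ C.W, C.c i k * f k u := by
    rw [← Finset.sum_neg_distrib]
    refine Finset.sum_congr rfl fun k hk => ?_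
    by_cases hc : C.c i k = 0
    · simp [hc]
    · rw [(hi.mem_upWalls hT hk hc).2]
      ring
  rw [hi.s_eq_neg_one hb hT, h₂] at h
  linarith

/-- Raising coordinates does not change the sign of a form that is not tight. -/
theorem sign_raise_of_not_tight {T : Finset ι} (hT : ∀ k ∈ T, k ∈ C.upWalls) {i : ι}
    (hi : ¬ C.Tight T i) :
    SignType.sign (f i (C.raise T)) = SignType.sign (f i v) ∧ f i v ≠ 0 := by
  classical
  unfold Tight at hi
  push Not at hi
  obtain ⟨k, hk, hc, hkv, hkT⟩ := hi
  have hpos : 0 < C.c i k * (C.s k * f k v) :=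
    mul_pos ((C.c_nonneg i k hk).lt_of_ne' hc) ((C.nonneg k).lt_of_ne' (mul_ne_zero
      (C.s_ne_zero k) hkv))
  have hv : 0 < C.s i * f i v := by
    rw [C.expand]
    exact hpos.trans_le (Finset.single_le_sum
      (f := fun k => C.c i k * (C.s k * f k v))
      (fun l hl => mul_nonneg (C.c_nonneg i l hl) (C.nonneg l)) hk)
  have hr : 0 < C.s i * f i (C.raise T) := by
    -- Only the raised coordinates decrease below zero, and then to `-ε`.
    have hle : ∀ l ∈ C.W, (if l = k then C.c i k * (C.s k * f k v) else 0) - C.ε * C.c i l ≤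
        C.c i l * (C.s l * f l (C.raise T)) := by
      intro l hl
      have hcl := C.c_nonneg i l hl
      have hεc : 0 ≤ C.ε * C.c i l := mul_nonneg C.ε_pos.le hcl
      by_cases hlT : l ∈ T
      · have hlk : l ≠ k := fun h => hkT (h ▸ hlT)
        rw [C.apply_raise_of_mem hT hlT, (hT l hlT).2, if_neg hlk]
        split_ifs
        · linarith
        · linarith
      · rw [C.apply_raise_of_notMem hT hl hlT]
        split_ifs with h
        · subst h; linarith
        · linarith [mul_nonneg hcl (C.nonneg l)]
    have hsum := Finset.sum_le_sum hle
    rw [← C.expand, Finset.sum_sub_distrib, Finset.sum_ite_eq' C.W k, if_pos hk,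
      ← Finset.mul_sum] at hsum
    linarith [C.ε_lt i k hk hpos]
  refine ⟨?_, fun h => by simp [h] at hv⟩
  rcases C.s_eq i with h | h
  · rw [h] at hv hr
    rw [sign_pos (by linarith), sign_pos (by linarith)]
  · rw [h] at hv hr
    rw [sign_neg (by linarith), sign_neg (by linarith)]

/-- Raising coordinates moves up. -/
theorem le_raise (hb : ∀ i, f i b < 0) {T : Finset ι} (hT : ∀ k ∈ T, k ∈ C.upWalls) :
    signVector f v ≤ signVector f (C.raise T) := by
  intro i
  by_cases hi : C.Tight T i
  · have hv : f i v ≤ 0 := by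
      have := C.nonneg i
      rw [hi.s_eq_neg_one hb hT] at this
      linarith
    have hr : 0 ≤ f i (C.raise T) := by
      rw [hi.apply_eq_sum hb hT]
      refine Finset.sum_nonneg fun k hk => ?_
      by_cases hc : C.c i k = 0
      · simp [hc]
      refine mul_nonneg (C.c_nonneg i k hk) ?_
      by_cases hkT : k ∈ T
      · exact (C.raised_raise hT hkT).2
      · rw [C.apply_raise_of_notMem hT hk hkT, (hi k hk hc).resolve_right hkT]
    exact sign_le_sign_iff_pos_nonneg.2 ⟨fun h => absurd h hv.not_gt, fun _ => hr⟩
  · exact (C.sign_raise_of_not_tight hT hi).1.ge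

/-- Raising the coordinates in `T` gives the least sign vector above that of `v` in which they
are raised. -/
theorem raise_le (hb : ∀ i, f i b < 0) {T : Finset ι} (hT : ∀ k ∈ T, k ∈ C.upWalls) {u : V}
    (hvu : signVector f v ≤ signVector f u) (hu : ∀ k ∈ T, C.Raised k u) :
    signVector f (C.raise T) ≤ signVector f u := by
  intro i
  by_cases hi : C.Tight T i
  · have hu0 : ∀ k ∈ C.W, 0 ≤ C.c i k * f k u := by
      intro k hk
      by_cases hc : C.c i k = 0
      · simp [hc]
      refine mul_nonneg (C.c_nonneg i k hk) ?_
      rcases hi k hk hc with h | h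
      · exact (sign_le_sign_iff_pos_nonneg.1 (hvu k)).2 h.ge
      · exact (hu k h).2
    refine sign_le_sign_iff_pos_nonneg.2 ⟨fun h => ?_, fun _ => ?_⟩
    · rw [hi.apply_eq_sum hb hT] at h ⊢
      obtain ⟨k, hk, hk0⟩ := Finset.exists_lt_of_sum_lt (f := fun _ => (0 : ℝ)) (by simpa using h)
      have hc : C.c i k ≠ 0 := fun h0 => by simp [h0] at hk0
      have hkr : 0 < f k (C.raise T) := pos_of_mul_pos_right hk0 (C.c_nonneg i k hk)
      have hkT : k ∈ T := by
        by_contra hkT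
        have hkv := (hi k hk hc).resolve_right hkT
        rw [C.apply_raise_of_notMem hT hk hkT, hkv] at hkr
        exact hkr.false
      have hkv : f k v = 0 := by
        by_contra hkv
        exact hkr.ne' (C.apply_raise_eq_zero hT hkT hkv)
      exact (mul_pos ((C.c_nonneg i k hk).lt_of_ne' hc) ((hu k hkT).1 hkv)).trans_le
        (Finset.single_le_sum (f := fun k => C.c i k * f k u) hu0 hk)
    · rw [hi.apply_eq_sum hb hT]
      exact Finset.sum_nonneg hu0
  · exact (C.sign_raise_of_not_tight hT hi).1.le.trans (hvu i)

theorem Raised.mono {C : SimplicialChart f v} {k : ι} {u w : V} (h : C.Raised k u)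
    (huw : signVector f u ≤ signVector f w) : C.Raised k w :=
  ⟨fun hv => (sign_le_sign_iff_pos_nonneg.1 (huw k)).1 (h.1 hv),
    (sign_le_sign_iff_pos_nonneg.1 (huw k)).2 h.2⟩

/-- In particular, raising `T ∪ T'` gives the join of raising `T` and raising `T'`. -/
theorem raise_le_iff (hb : ∀ i, f i b < 0) {T : Finset ι} (hT : ∀ k ∈ T, k ∈ C.upWalls) {u : V} :
    signVector f (C.raise T) ≤ signVector f u ↔
      signVector f v ≤ signVector f u ∧ ∀ k ∈ T, C.Raised k u :=
  ⟨fun h => ⟨(C.le_raise hb hT).trans h, fun _ hk => (C.raised_raise hT hk).mono h⟩,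
    fun h => C.raise_le hb hT h.1 h.2⟩

/-- The steps out of `v` generate the order: a sign vector above that of `v` in which no up wall
is raised is that of a point of the same face. -/
theorem le_of_forall_not_raised {u : V} (hvu : signVector f v ≤ signVector f u)
    (hu : ∀ k ∈ C.upWalls, ¬ C.Raised k u) : signVector f u ≤ signVector f v := by
  have hW : ∀ k ∈ C.W, SignType.sign (C.s k * f k u) = SignType.sign (C.s k * f k v) := by
    intro k hk
    have hle := sign_le_sign_iff_pos_nonneg.1 (hvu k)
    have h0 := C.nonneg k
    rcases C.s_eq k with h | h
    · have hv : f k v ≠ 0 := fun h' => by have := C.s_of_eq_zero k h'; linarith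
      rw [h, one_mul] at h0
      have hpos := h0.lt_of_ne' hv
      rw [h, one_mul, one_mul, sign_pos hpos, sign_pos (hle.1 hpos)]
    · have hk' : k ∈ C.upWalls := ⟨hk, h⟩
      have hnr := hu k hk'
      simp only [Raised, not_and_or, not_le, Classical.not_imp, not_lt] at hnr
      rw [h] at h0 ⊢
      rcases hnr with ⟨hv, hu'⟩ | hu'
      · rw [hv, le_antisymm hu' (hle.2 hv.ge)]
      · have hv : f k v < 0 := not_le.1 fun h' => hu'.not_ge (hle.2 h')
        rw [sign_pos (by linarith), sign_pos (by linarith)]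
  intro i
  refine le_of_eq ?_
  have hs : SignType.sign (C.s i * f i u) = SignType.sign (C.s i * f i v) := by
    have hnn : ∀ k ∈ C.W, 0 ≤ C.c i k * (C.s k * f k u) := fun k hk =>
      mul_nonneg (C.c_nonneg i k hk) (sign_nonneg_iff.1 (hW k hk ▸ sign_nonneg_iff.2 (C.nonneg k)))
    have hnn' : ∀ k ∈ C.W, 0 ≤ C.c i k * (C.s k * f k v) := fun k hk =>
      mul_nonneg (C.c_nonneg i k hk) (C.nonneg k)
    have hz : C.s i * f i u = 0 ↔ C.s i * f i v = 0 := by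
      rw [C.expand, C.expand, Finset.sum_eq_zero_iff_of_nonneg hnn,
        Finset.sum_eq_zero_iff_of_nonneg hnn']
      refine forall₂_congr fun k hk => ?_
      have hk0 : C.s k * f k u = 0 ↔ C.s k * f k v = 0 := by
        rw [← sign_eq_zero_iff, hW k hk, sign_eq_zero_iff]
      rw [mul_eq_zero (a := C.c i k), mul_eq_zero (a := C.c i k), hk0]
    have h₁ : 0 ≤ C.s i * f i u := by rw [C.expand]; exact Finset.sum_nonneg hnn
    have h₂ := C.nonneg i
    rcases h₂.eq_or_lt with h | h
    · rw [← h, hz.2 h.symm]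
    · rw [sign_pos h, sign_pos (h₁.lt_of_ne' fun h' => h.ne' (hz.1 h'))]
  rw [sign_mul, sign_mul] at hs
  rcases C.s_eq i with h | h <;> simpa [h, signVector] using hs

/-- If `u` is not below `v` but is below every step out of `v`, then only one sign is greater at
`u` than at `v`, and only by one. For a minimal `u` not below `v`, this is applied to `-u`
and `-v`. -/
theorem exists_unique_sign_jump (hb : ∀ i, f i b < 0)
    (hf : ∀ i j, (∀ u, f i u = 0 ↔ f j u = 0) → i = j) {u : V}
    (huv : ¬ signVector f u ≤ signVector f v)
    (hu : ∀ k ∈ C.upWalls, signVector f u ≤ signVector f (C.raise {k})) :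
    ∃ i₀, (∀ i ≠ i₀, signVector f u i ≤ signVector f v i) ∧
      (signVector f v i₀ = -1 ∧ signVector f u i₀ = 0 ∨
        signVector f v i₀ = 0 ∧ signVector f u i₀ = 1) := by
  have hsub : ∀ k ∈ C.upWalls, ∀ l ∈ ({k} : Finset ι), l ∈ C.upWalls := fun k hk l hl => by
    rwa [Finset.mem_singleton.1 hl]
  have hne : C.upWalls.Nonempty := by
    by_contra hne
    rw [Set.not_nonempty_iff_eq_empty] at hne
    have htop : ∀ w, signVector f w ≤ signVector f (-b) := fun w i =>
      sign_le_sign_iff_pos_nonneg.2 ⟨fun _ => by simpa using hb i, fun _ => by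
        simpa using (hb i).le⟩
    exact huv ((htop u).trans (C.le_of_forall_not_raised (htop v) (by simp [hne])))
  have htight : ∀ i, ¬ signVector f u i ≤ signVector f v i → ∀ k ∈ C.upWalls, C.Tight {k} i :=
    fun i hi k hk => by
      by_contra h
      exact hi ((hu k hk i).trans (C.sign_raise_of_not_tight (hsub k hk) h).1.le)
  have hraise_other : ∀ k ∈ C.upWalls, ∀ l ∈ C.W, l ≠ k → f l (C.raise {k}) = f l v :=
    fun k hk l hl hlk => C.apply_raise_of_notMem (hsub k hk) hl (by simpa using hlk)
  have hbad : ∃ i, ¬ signVector f u i ≤ signVector f v i := by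
    simpa [Pi.le_def] using huv
  obtain ⟨i, hi⟩ := hbad
  -- There is only one up wall.
  have hss : C.upWalls.Subsingleton := by
    by_cases hiv : f i v = 0
    · -- Here `f i` is a combination of up walls that vanish at `v`; if there were two of them,
      -- each would remain zero in a step across the other, so that none is positive at `u`.
      intro k₁ hk₁ k₂ hk₂
      by_contra hk
      have hle : f i u ≤ 0 := by
        rw [(htight i hi k₁ hk₁).apply_eq_sum hb (hsub k₁ hk₁)]
        refine Finset.sum_nonpos fun l hl => ?_
        by_cases hc : C.c i l = 0
        · simp [hc]
        refine mul_nonpos_of_nonneg_of_nonpos (C.c_nonneg i l hl) ?_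
        have hlv := C.apply_eq_zero_of_coeff_ne_zero hiv hl hc
        obtain ⟨k, hk, hlk⟩ : ∃ k ∈ C.upWalls, l ≠ k := by
          by_cases h : l = k₁
          · exact ⟨k₂, hk₂, h ▸ hk⟩
          · exact ⟨k₁, hk₁, h⟩
        have := (sign_le_sign_iff_pos_nonneg.1 (hu k hk l)).1
        rw [hraise_other k hk l hl hlk, hlv] at this
        exact not_lt.1 fun h => (this h).false
      refine hi (sign_le_sign_iff_pos_nonneg.2 ⟨fun h => absurd h hle.not_gt, fun _ => hiv.ge⟩)
    · -- Here some `f l` with `f l v ≠ 0` occurs in `f i`, and every up wall must be `l`.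
      obtain ⟨l, hl, hc, hlv⟩ : ∃ l ∈ C.W, C.c i l ≠ 0 ∧ f l v ≠ 0 := by
        by_contra! h
        refine hiv ?_
        rw [C.apply_eq, C.expand, Finset.sum_eq_zero, mul_zero]
        intro l hl
        by_cases hc : C.c i l = 0
        · simp [hc]
        · simp [h l hl hc]
      have hall : ∀ k ∈ C.upWalls, k = l := fun k hk =>
        (Finset.mem_singleton.1 ((htight i hi k hk l hl hc).resolve_left hlv)).symm
      exact fun k₁ hk₁ k₂ hk₂ => (hall k₁ hk₁).trans (hall k₂ hk₂).symm
  obtain ⟨k, hk⟩ := hne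
  have hbad_eq : ∀ i, ¬ signVector f u i ≤ signVector f v i → i = k := by
    intro i hi
    have ht := htight i hi k hk
    have hsum : ∀ w, f i w = C.c i k * f k w := fun w => by
      rw [ht.apply_eq_sum hb (hsub k hk)]
      refine Finset.sum_eq_single_of_mem k hk.1 fun l hl hlk => ?_
      by_cases hc : C.c i l = 0
      · simp [hc]
      · exact absurd (hss (ht.mem_upWalls (hsub k hk) hl hc) hk) hlk
    have hc : C.c i k ≠ 0 := fun h => (hb i).ne (by rw [hsum, h, zero_mul])
    exact hf i k fun w => by simp [hsum, hc]
  have hik := hbad_eq i hi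
  subst hik
  refine ⟨i, fun j hj => by_contra fun h => hj (hbad_eq j h), ?_⟩
  have hle := hu i hk i
  simp only [signVector] at hi hle ⊢
  rw [C.apply_raise_of_mem (hsub i hk) (Finset.mem_singleton_self i)] at hle
  rcases (C.nonpos_of_mem_upWalls hk).eq_or_lt with h | h
  · right
    rw [h, sign_zero] at hi ⊢
    have key : ∀ a : SignType, ¬ a ≤ 0 → a = 1 := by decide
    exact ⟨rfl, key _ hi⟩
  · left
    rw [if_neg h.ne, sign_zero] at hle
    rw [sign_neg h] at hi ⊢
    have key : ∀ a : SignType, ¬ a ≤ -1 → a ≤ 0 → a = 0 := by decide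
    exact ⟨rfl, key _ hi hle⟩

/-- The local form of meet-semidistributivity: if only one sign is greater at `t` than at `v`,
and only by one, and if `t` lies below the join of two steps out of `v`, then `t` lies below
one of the two steps. -/
theorem le_raise_or_le_raise [DecidableEq ι] (hb : ∀ i, f i b < 0) {k₁ k₂ : ι}
    (hk₁ : k₁ ∈ C.upWalls) (hk₂ : k₂ ∈ C.upWalls) {t : V} {i₀ : ι}
    (ht : signVector f t ≤ signVector f (C.raise {k₁, k₂}))
    (hlt : ∀ i ≠ i₀, signVector f t i ≤ signVector f v i)
    (hi₀ : signVector f v i₀ = -1 ∧ signVector f t i₀ = 0 ∨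
      signVector f v i₀ = 0 ∧ signVector f t i₀ = 1) :
    ∃ k ∈ ({k₁, k₂} : Finset ι), signVector f t ≤ signVector f (C.raise {k}) := by
  have hT : ∀ k ∈ ({k₁, k₂} : Finset ι), k ∈ C.upWalls := by
    simp [hk₁, hk₂]
  have hsub : ∀ k ∈ C.upWalls, ∀ l ∈ ({k} : Finset ι), l ∈ C.upWalls := fun k hk l hl => by
    rwa [Finset.mem_singleton.1 hl]
  generalize ({k₁, k₂} : Finset ι) = T at ht hT ⊢
  have hjump : ¬ signVector f t i₀ ≤ signVector f v i₀ := by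
    rcases hi₀ with ⟨h₁, h₂⟩ | ⟨h₁, h₂⟩ <;> rw [h₁, h₂] <;> decide
  have htight : C.Tight T i₀ := by
    by_contra h
    exact hjump ((ht i₀).trans (C.sign_raise_of_not_tight hT h).1.le)
  have hfin : ∀ k ∈ T, signVector f t i₀ ≤ signVector f (C.raise {k}) i₀ →
      signVector f t ≤ signVector f (C.raise {k}) := by
    intro k hk h i
    by_cases hi : i = i₀
    · rwa [hi]
    · exact (hlt i hi).trans (C.le_raise hb (hsub k (hT k hk)) i)
  rcases hi₀ with ⟨h₁, h₂⟩ | ⟨h₁, h₂⟩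
  · -- The sign jumps from negative to zero: then `i₀` itself is one of the raised walls.
    have hi₀T : i₀ ∈ T := by
      by_contra hi₀T
      simp only [signVector] at h₁ h₂
      rw [sign_eq_neg_one_iff] at h₁
      rw [sign_eq_zero_iff] at h₂
      have hneg : ∀ l ∈ C.W, C.c i₀ l ≠ 0 → f l t ≤ 0 ∧ (f l t = 0 → f l v = 0) := by
        intro l hl hc
        have hl₀ : l ≠ i₀ := by
          rintro rfl
          exact (htight l hl hc).elim h₁.ne hi₀T
        have hlv := C.nonpos_of_mem_upWalls (htight.mem_upWalls hT hl hc)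
        have hle := sign_le_sign_iff_pos_nonneg.1 (hlt l hl₀)
        exact ⟨not_lt.1 fun h => hlv.not_gt (hle.1 h),
          fun h => le_antisymm hlv (hle.2 h.ge)⟩
      rw [htight.apply_eq_sum hb hT, Finset.sum_eq_zero_iff_of_nonpos fun l hl => by
        by_cases hc : C.c i₀ l = 0
        · simp [hc]
        · exact mul_nonpos_of_nonneg_of_nonpos (C.c_nonneg _ l hl) (hneg l hl hc).1] at h₂
      refine h₁.ne ?_
      rw [htight.apply_eq_sum hb hT]
      refine Finset.sum_eq_zero fun l hl => ?_
      by_cases hc : C.c i₀ l = 0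
      · simp [hc]
      · rw [(hneg l hl hc).2 ((mul_eq_zero.1 (h₂ l hl)).resolve_left hc), mul_zero]
    refine ⟨i₀, hi₀T, hfin i₀ hi₀T ?_⟩
    rw [h₂]
    exact sign_nonneg_iff.2
      (C.raised_raise (hsub i₀ (hT i₀ hi₀T)) (Finset.mem_singleton_self i₀)).2
  · -- The sign jumps from zero to positive: some raised wall occurs in `f i₀`.
    have hpos : 0 < f i₀ (C.raise T) := by
      have := ht i₀
      rw [h₂] at this
      exact (sign_le_sign_iff_pos_nonneg.1 ((sign_pos one_pos).trans_le this)).1 one_pos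
    simp only [signVector] at h₁
    rw [sign_eq_zero_iff] at h₁
    have hzero : ∀ l ∈ C.W, C.c i₀ l ≠ 0 → f l v = 0 := fun l hl hc =>
      C.apply_eq_zero_of_coeff_ne_zero h₁ hl hc
    rw [htight.apply_eq_sum hb hT] at hpos
    obtain ⟨l, hl, hl0⟩ := Finset.exists_lt_of_sum_lt (f := fun _ => (0 : ℝ)) (by simpa using hpos)
    have hc : C.c i₀ l ≠ 0 := fun h0 => by simp [h0] at hl0
    have hlT : l ∈ T := by
      by_contra hlT
      rw [C.apply_raise_of_notMem hT hl hlT, hzero l hl hc, mul_zero] at hl0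
      exact hl0.false
    refine ⟨l, hlT, hfin l hlT ?_⟩
    rw [h₂]
    refine (sign_pos ?_).ge
    have htight' : C.Tight {l} i₀ := fun m hm hcm => Or.inl (hzero m hm hcm)
    rw [htight'.apply_eq_sum hb (hsub l (hT l hlT))]
    refine (mul_pos ((C.c_nonneg _ l hl).lt_of_ne' hc)
      ((C.raised_raise (hsub l (hT l hlT)) (Finset.mem_singleton_self l)).1
        (hzero l hl hc))).trans_le
      (Finset.single_le_sum (f := fun m => C.c i₀ m * f m (C.raise {l})) (fun m hm => ?_) hl)
    by_cases hcm : C.c i₀ m = 0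
    · simp [hcm]
    · exact mul_nonneg (C.c_nonneg _ m hm) ((sign_le_sign_iff_pos_nonneg.1
        (C.le_raise hb (hsub l (hT l hlT)) m)).2 (hzero m hm hcm).ge)

end SimplicialChart

/-! ### The lattice of sign vectors -/

section SignVectorLattice

variable {V ι : Type*} [AddCommGroup V] [Module ℝ V] {f : ι → V →ₗ[ℝ] ℝ}

/-- The antipodal map as an order-reversing bijection of the set of sign vectors. -/
def signVectorNeg (f : ι → V →ₗ[ℝ] ℝ) :
    Set.range (signVector f) ≃o (Set.range (signVector f))ᵒᵈ where
  toFun p := OrderDual.toDual ⟨-p.1, by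
    obtain ⟨v, hv⟩ := p.2
    exact ⟨-v, by rw [signVector_neg, hv]⟩⟩
  invFun p := ⟨-(OrderDual.ofDual p).1, by
    obtain ⟨v, hv⟩ := (OrderDual.ofDual p).2
    exact ⟨-v, by rw [signVector_neg, hv]⟩⟩
  left_inv p := Subtype.ext (funext fun i => neg_neg (p.1 i))
  right_inv p := Subtype.ext (funext fun i => neg_neg ((OrderDual.ofDual p).1 i))
  map_rel_iff' {p q} := by
    have key : ∀ a b : SignType, -b ≤ -a ↔ a ≤ b := by decide
    exact forall_congr' fun i => key (p.1 i) (q.1 i)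

/-- A minimal sign vector `t` that is not below `v` exceeds it in one place only, and only
by one. -/
theorem exists_le_sign_jump [Finite ι] {b : V} (hb : ∀ i, f i b < 0)
    (hf : ∀ i j, (∀ u, f i u = 0 ↔ f j u = 0) → i = j) (hC : ∀ v, Nonempty (SimplicialChart f v))
    {u v : V} (huv : ¬ signVector f u ≤ signVector f v) :
    ∃ t, signVector f t ≤ signVector f u ∧ ∃ i₀,
      (∀ i ≠ i₀, signVector f t i ≤ signVector f v i) ∧
      (signVector f v i₀ = -1 ∧ signVector f t i₀ = 0 ∨
        signVector f v i₀ = 0 ∧ signVector f t i₀ = 1) := by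
  have hfin : (Set.range (signVector f)).Finite := Set.toFinite _
  obtain ⟨_, ⟨⟨t, rfl⟩, htu, htv⟩, hmin⟩ := (hfin.subset (Set.sep_subset _ fun x =>
    x ≤ signVector f u ∧ ¬ x ≤ signVector f v)).exists_minimal ⟨_, ⟨u, rfl⟩, le_rfl, huv⟩
  refine ⟨t, htu, ?_⟩
  have key : ∀ a b : SignType, -b ≤ -a ↔ a ≤ b := by decide
  have hneg : ∀ x y : V, signVector f (-y) ≤ signVector f (-x) ↔
      signVector f x ≤ signVector f y := fun x y => by
    rw [signVector_neg, signVector_neg]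
    exact forall_congr' fun i => key _ _
  obtain ⟨C⟩ := hC (-t)
  -- A step out of `-t` gives a sign vector strictly below that of `t`, hence below that of `v`.
  obtain ⟨i₀, h₁, h₂⟩ := C.exists_unique_sign_jump hb hf (u := -v) (by rwa [hneg]) (by
    intro k hk
    have hsub : ∀ l ∈ ({k} : Finset ι), l ∈ C.upWalls := fun l hl => by
      rwa [Finset.mem_singleton.1 hl]
    by_contra h
    have hle := C.le_raise hb hsub
    have hr : ¬ signVector f (-C.raise {k}) ≤ signVector f v := by
      rwa [← hneg, neg_neg]
    have hrt : signVector f (-C.raise {k}) ≤ signVector f t := by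
      rwa [← hneg, neg_neg]
    have := hmin ⟨⟨_, rfl⟩, hrt.trans htu, hr⟩ hrt
    rw [← hneg, neg_neg] at this
    exact C.not_raised hk
      ((C.raised_raise hsub (Finset.mem_singleton_self k)).mono this))
  refine ⟨i₀, fun i hi => ?_, ?_⟩
  · have := h₁ i hi
    rwa [signVector_neg, signVector_neg, Pi.neg_apply, Pi.neg_apply, key] at this
  · rw [signVector_neg, signVector_neg, Pi.neg_apply, Pi.neg_apply] at h₂
    revert h₂
    generalize signVector f t i₀ = x
    generalize signVector f v i₀ = y
    revert x y
    decide

/-- If there are simplicial charts at all points, then the sign vectors, ordered componentwise,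
form a semidistributive lattice. -/
theorem exists_isSemidistributive_signVector [Finite ι] {b : V} (hb : ∀ i, f i b < 0)
    (hf : ∀ i j, (∀ u, f i u = 0 ↔ f j u = 0) → i = j)
    (hC : ∀ v, Nonempty (SimplicialChart f v)) :
    ∃ L : Lattice (Set.range (signVector f)),
      (∀ p q, L.le p q ↔ p.1 ≤ q.1) ∧ @IsSemidistributive _ L := by
  classical
  let P := Set.range (signVector f)
  have hrep : ∀ p : P, ∃ v, signVector f v = p.1 := fun p => p.2
  choose rep hrep using hrep
  let C : ∀ p : P, SimplicialChart f (rep p) := fun p => (hC (rep p)).some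
  let r : P → Finset ι → P := fun p T => ⟨signVector f ((C p).raise T), ⟨_, rfl⟩⟩
  let step : P → P → Prop := fun p q => ∃ k ∈ (C p).upWalls, q = r p {k}
  have hsub : ∀ p, ∀ k ∈ (C p).upWalls, ∀ l ∈ ({k} : Finset ι), l ∈ (C p).upWalls :=
    fun p k hk l hl => by rwa [Finset.mem_singleton.1 hl]
  have hr : ∀ p T, (∀ k ∈ T, k ∈ (C p).upWalls) → ∀ q : P,
      r p T ≤ q ↔ p ≤ q ∧ ∀ k ∈ T, (C p).Raised k (rep q) := by
    intro p T hT q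
    have := (C p).raise_le_iff hb hT (u := rep q)
    rwa [hrep, hrep] at this
  have step_lt : ∀ p q, step p q → p < q := by
    rintro p _ ⟨k, hk, rfl⟩
    have hle := (hr p {k} (hsub p k hk) _).1 le_rfl
    refine hle.1.lt_of_ne fun h => (C p).not_raised hk ?_
    have := hle.2 k (Finset.mem_singleton_self k)
    rwa [← h] at this
  have exists_step : ∀ p u, p < u → ∃ q, step p q ∧ q ≤ u := by
    intro p u hpu
    have hpu' : signVector f (rep p) ≤ signVector f (rep u) := by
      rw [hrep, hrep]; exact hpu.le
    obtain ⟨k, hk, hku⟩ : ∃ k ∈ (C p).upWalls, (C p).Raised k (rep u) := by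
      by_contra! h
      have := (C p).le_of_forall_not_raised hpu' h
      rw [hrep, hrep] at this
      exact hpu.not_ge this
    exact ⟨_, ⟨k, hk, rfl⟩, (hr p {k} (hsub p k hk) u).2 ⟨hpu.le, by simpa using hku⟩⟩
  have isLUB_raise : ∀ p, ∀ k ∈ (C p).upWalls, ∀ l ∈ (C p).upWalls,
      IsLUB {r p {k}, r p {l}} (r p {k, l}) := by
    intro p k hk l hl
    have hT : ∀ m ∈ ({k, l} : Finset ι), m ∈ (C p).upWalls := by simp [hk, hl]
    have hkl := (hr p _ hT _).1 le_rfl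
    refine ⟨?_, fun u hu => ?_⟩
    · rintro _ (rfl | rfl)
      · exact (hr p _ (hsub p k hk) _).2 ⟨hkl.1, fun m hm => hkl.2 m (by
          rw [Finset.mem_singleton.1 hm]; simp)⟩
      · exact (hr p _ (hsub p l hl) _).2 ⟨hkl.1, fun m hm => hkl.2 m (by
          rw [Finset.mem_singleton.1 hm]; simp)⟩
    · have hku := (hr p _ (hsub p k hk) u).1 (hu (by simp))
      have hlu := (hr p _ (hsub p l hl) u).1 (hu (by simp))
      refine (hr p _ hT u).2 ⟨hku.1, fun m hm => ?_⟩
      rcases Finset.mem_insert.1 hm with rfl | hm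
      · exact hku.2 _ (Finset.mem_singleton_self _)
      · exact hlu.2 _ hm
  have hlub : ∀ x y : P, ∃ q, IsLUB {x, y} q := by
    have hbot : ∀ q : P, (⟨signVector f b, ⟨b, rfl⟩⟩ : P) ≤ q := fun q i => by
      change SignType.sign (f i b) ≤ _
      rw [sign_neg (hb i)]
      exact SignType.neg_one_le _
    intro x y
    refine exists_isLUB_of_step step step_lt exists_step ?_ _ x y (hbot x) (hbot y)
    rintro p _ _ ⟨k, hk, rfl⟩ ⟨l, hl, rfl⟩
    exact ⟨_, isLUB_raise p k hk l hl⟩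
  have hglb : ∀ x y : P, ∃ q, IsGLB {x, y} q := by
    intro x y
    let φ := signVectorNeg f
    obtain ⟨q, hq⟩ := hlub (OrderDual.ofDual (φ x)) (OrderDual.ofDual (φ y))
    refine ⟨φ.symm (OrderDual.toDual q), ?_, fun u hu => ?_⟩
    · rintro z hz
      refine (φ.symm_apply_le).2 (hq.1 ?_)
      exact hz.imp (congrArg φ) (congrArg φ)
    · refine (φ.le_symm_apply).2 (hq.2 ?_)
      rintro z (rfl | rfl)
      · exact φ.monotone (hu (by simp))
      · exact φ.monotone (hu (by simp))
  let L : Lattice P := latticeOfIsLUBIsGLB hlub hglb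
  refine ⟨L, fun _ _ => Iff.rfl, ?_⟩
  refine IsMeetSemidistributive.isSemidistributive ?_ (signVectorNeg f)
  refine isMeetSemidistributive_of_step step step_lt exists_step ?_
  rintro p _ _ ⟨k, hk, rfl⟩ ⟨l, hl, rfl⟩ u hu hup
  have hu' : u ≤ r p {k, l} := hu.trans_eq
    (isLUB_pair.unique (isLUB_raise p k hk l hl))
  obtain ⟨t, htu, i₀, ht, hi₀⟩ := exists_le_sign_jump hb hf hC (u := rep u) (v := rep p)
    (by rwa [hrep, hrep])
  rw [hrep u] at htu
  refine ⟨⟨signVector f t, ⟨t, rfl⟩⟩, htu, fun h => ?_, ?_⟩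
  · have h := h i₀
    rw [← hrep p] at h
    change signVector f t i₀ ≤ signVector f (rep p) i₀ at h
    rcases hi₀ with ⟨h₁, h₂⟩ | ⟨h₁, h₂⟩ <;> rw [h₁, h₂] at h <;> revert h <;> decide
  · obtain ⟨m, hm, hle⟩ := (C p).le_raise_or_le_raise hb hk hl (htu.trans hu') ht hi₀
    rcases Finset.mem_insert.1 hm with rfl | hm
    · exact Or.inl hle
    · rw [Finset.mem_singleton.1 hm] at hle
      exact Or.inr hle

end SignVectorLattice

/-! ### Regions and faces in terms of sign vectors -/

section ClosedCells

variable {V ι : Type*} [AddCommGroup V] [Module ℝ V] {f : ι → V →ₗ[ℝ] ℝ}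

/-- The closed region of the point `x` (on none of the hyperplanes): the points that lie weakly on
the same side of every hyperplane as `x`. -/
def closedRegion (f : ι → V →ₗ[ℝ] ℝ) (x : V) : Set V :=
  {v | ∀ i, 0 ≤ signVector f x i * signVector f v i}

/-- The closed face of the point `v`: the points whose sign vector is obtained from that of `v` by
replacing some entries by zero. -/
def closedFace (f : ι → V →ₗ[ℝ] ℝ) (v : V) : Set V :=
  {w | ∀ i, signVector f w i = 0 ∨ signVector f w i = signVector f v i}

theorem signVector_mul_nonneg_iff {x v : V} {i : ι} :
    0 ≤ signVector f x i * signVector f v i ↔ 0 ≤ f i x * f i v := by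
  rw [signVector, signVector, ← sign_mul, sign_nonneg_iff]

theorem self_mem_closedFace (v : V) : v ∈ closedFace f v := fun _ => Or.inr rfl

theorem closedFace_eq_iff {v w : V} :
    closedFace f v = closedFace f w ↔ signVector f v = signVector f w := by
  refine ⟨fun h => funext fun i => ?_, fun h => by rw [closedFace, closedFace, h]⟩
  have h₁ : v ∈ closedFace f w := h ▸ self_mem_closedFace v
  have h₂ : w ∈ closedFace f v := h ▸ self_mem_closedFace w
  have key : ∀ a b : SignType, (a = 0 ∨ a = b) → (b = 0 ∨ b = a) → a = b := by decide
  exact key _ _ (h₁ i) (h₂ i)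

theorem closedFace_subset_closedRegion_iff {v x : V} :
    closedFace f v ⊆ closedRegion f x ↔ v ∈ closedRegion f x := by
  refine ⟨fun h => h (self_mem_closedFace v), fun h w hw i => ?_⟩
  rcases hw i with h0 | h0
  · simp [h0]
  · rw [h0]; exact h i

/-- The composition of the sign vectors of `v` and `b` is the sign vector of a point, namely of
`v + ε • b` for small `ε > 0`. -/
theorem exists_signVector_eq_ite [Finite ι] (v b : V) : ∃ x, ∀ i,
    signVector f x i = if signVector f v i = 0 then signVector f b i else signVector f v i := by
  have hev : ∀ᶠ ε : ℝ in nhdsWithin 0 (Set.Ioi 0), ∀ i,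
      f i v ≠ 0 → 0 < f i v * (f i v + ε * f i b) := by
    rw [Filter.eventually_all]
    intro i
    by_cases hi : f i v = 0
    · simp [hi]
    have hcont : Filter.Tendsto (fun ε : ℝ => f i v * (f i v + ε * f i b))
        (nhdsWithin 0 (Set.Ioi 0)) (nhds (f i v * (f i v + 0 * f i b))) :=
      ((by fun_prop : Continuous fun ε : ℝ => f i v * (f i v + ε * f i b)).tendsto 0).mono_left
        nhdsWithin_le_nhds
    have hpos : 0 < f i v * (f i v + 0 * f i b) := by
      rw [zero_mul, add_zero]; exact mul_self_pos.2 hi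
    filter_upwards [hcont.eventually_const_lt hpos] with ε hε _ using hε
  obtain ⟨ε, hε, hε0⟩ := (hev.and self_mem_nhdsWithin).exists
  refine ⟨v + ε • b, fun i => ?_⟩
  simp only [signVector, map_add, map_smul, smul_eq_mul, sign_eq_zero_iff]
  split_ifs with h
  · rw [h, zero_add, sign_mul, sign_pos hε0, one_mul]
  · have := hε i h
    rcases lt_or_gt_of_ne h with h' | h'
    · rw [sign_neg h', sign_neg (neg_of_mul_pos_right this h'.le)]
    · rw [sign_pos h', sign_pos (pos_of_mul_pos_right this h'.le)]

end ClosedCells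

/-- The linear forms given by the inner products with the vectors `e i`. -/
noncomputable abbrev normalForms {V ι : Type*} [NormedAddCommGroup V]
    [InnerProductSpace ℝ V] (e : ι → V) : ι → V →ₗ[ℝ] ℝ :=
  fun i => innerₗ V (e i)

namespace HyperplaneArrangement

variable {V : Type*} [NormedAddCommGroup V] [InnerProductSpace ℝ V]
  {A : HyperplaneArrangement V}

/-- Linear forms for the hyperplanes of an arrangement: `f H` vanishes exactly on `H`. -/
def IsFormFamily (A : HyperplaneArrangement V) (f : A.hyperplanes → V →ₗ[ℝ] ℝ) : Prop :=
  ∀ (H : A.hyperplanes) (v : V), v ∈ H.1 ↔ f H v = 0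

variable {f : A.hyperplanes → V →ₗ[ℝ] ℝ}

theorem IsFormFamily.mem_complement_iff (hf : A.IsFormFamily f) {x : V} :
    x ∈ A.complement ↔ ∀ i, signVector f x i ≠ 0 := by
  simp only [complement, Set.mem_ofPred_eq, signVector, Ne, sign_eq_zero_iff, ← hf _ x,
    Subtype.forall]

/-- The connected components of the complement are the open cones of constant sign vector, and
their closures are cut out by the weak inequalities. -/
theorem IsFormFamily.closure_connectedComponentIn [FiniteDimensional ℝ V] (hf : A.IsFormFamily f)
    {x : V} (hx : x ∈ A.complement) :
    closure (connectedComponentIn A.complement x) = closedRegion f x := by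
  have hx' := hf.mem_complement_iff.1 hx
  have hx0 : ∀ i, f i x ≠ 0 := fun i h => hx' i (by simp [signVector, h])
  have hcont : ∀ i, Continuous (f i) := fun i => (f i).continuous_of_finiteDimensional
  have hcomp : connectedComponentIn A.complement x = {v | ∀ i, 0 < f i x * f i v} := by
    apply subset_antisymm
    · intro y hy i
      by_contra hle
      have hIcc := isPreconnected_connectedComponentIn.intermediate_value hy
        (mem_connectedComponentIn hx) (f := fun v => f i x * f i v)
        ((continuous_const.mul (hcont i)).continuousOn)
      obtain ⟨z, hz, hz0⟩ := hIcc ⟨not_lt.1 hle, mul_self_nonneg _⟩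
      have hz' := hf.mem_complement_iff.1 (connectedComponentIn_subset _ _ hz) i
      refine hz' ?_
      rw [signVector, sign_eq_zero_iff]
      exact (mul_eq_zero.1 hz0).resolve_left (hx0 i)
    · refine IsPreconnected.subset_connectedComponentIn ?_ (fun i => mul_self_pos.2 (hx0 i)) ?_
      · refine Convex.isPreconnected fun v hv w hw a b ha hb hab i => ?_
        have hsum : f i x * f i (a • v + b • w) = a * (f i x * f i v) + b * (f i x * f i w) := by
          simp only [map_add, map_smul, smul_eq_mul]; ring
        rw [hsum]
        have hv := hv i
        have hw := hw i
        rcases ha.eq_or_lt with rfl | ha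
        · rw [zero_add] at hab
          rw [hab]; linarith
        · exact add_pos_of_pos_of_nonneg (mul_pos ha hv) (mul_nonneg hb hw.le)
      · intro v hv
        refine hf.mem_complement_iff.2 fun i h => ?_
        have := hv i
        rw [sign_eq_zero_iff.1 h, mul_zero] at this
        exact this.false
  rw [hcomp]
  apply subset_antisymm
  · refine closure_minimal (fun v hv i => signVector_mul_nonneg_iff.2 (hv i).le) ?_
    have : closedRegion f x = ⋂ i, {v | 0 ≤ f i x * f i v} := by
      ext v
      simp only [closedRegion, signVector_mul_nonneg_iff, Set.mem_ofPred_eq, Set.mem_iInter]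
    rw [this]
    exact isClosed_iInter fun i => isClosed_le continuous_const (continuous_const.mul (hcont i))
  · intro v hv
    have hlim : Filter.Tendsto (fun t : ℝ => v + t • x) (nhdsWithin 0 (Set.Ioi 0)) (nhds v) := by
      have : Filter.Tendsto (fun t : ℝ => v + t • x) (nhds 0) (nhds (v + (0 : ℝ) • x)) :=
        (by fun_prop : Continuous fun t : ℝ => v + t • x).tendsto 0
      rw [zero_smul, add_zero] at this
      exact this.mono_left nhdsWithin_le_nhds
    refine mem_closure_of_tendsto hlim ?_
    filter_upwards [self_mem_nhdsWithin] with t ht i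
    have h₁ := signVector_mul_nonneg_iff.1 (hv i)
    have h₂ : 0 < t * (f i x * f i x) := mul_pos ht (mul_self_pos.2 (hx0 i))
    simp only [map_add, map_smul, smul_eq_mul]
    linarith

theorem IsFormFamily.isRegion_iff [FiniteDimensional ℝ V] (hf : A.IsFormFamily f) {R : Set V} :
    A.IsRegion R ↔ ∃ x, (∀ i, signVector f x i ≠ 0) ∧ R = closedRegion f x := by
  constructor
  · rintro ⟨x, hx, rfl⟩
    exact ⟨x, hf.mem_complement_iff.1 hx, hf.closure_connectedComponentIn hx⟩
  · rintro ⟨x, hx, rfl⟩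
    exact ⟨x, hf.mem_complement_iff.2 hx,
      (hf.closure_connectedComponentIn (hf.mem_complement_iff.2 hx)).symm⟩

/-- The faces are the closed faces of points. A point whose closed face is a given intersection
of regions is one that lies on as few hyperplanes as possible. -/
theorem IsFormFamily.isFace_iff [FiniteDimensional ℝ V] (hf : A.IsFormFamily f) {b : V}
    (hb : ∀ i, signVector f b i = -1) {F : Set V} :
    A.IsFace F ↔ ∃ v, F = closedFace f v := by
  classical
  constructor
  · rintro ⟨𝓡, ⟨R₀, hR₀⟩, hreg, rfl⟩
    -- Intersections of regions are closed under addition, so that a point of maximal support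
    -- has the supports of all other points inside its own.
    let supp : V → Finset A.hyperplanes := fun v => Finset.univ.filter fun i => f i v ≠ 0
    have hreg' : ∀ R ∈ 𝓡, ∃ x, (∀ i, signVector f x i ≠ 0) ∧ R = closedRegion f x := fun R hR =>
      hf.isRegion_iff.1 (hreg R hR)
    have hadd : ∀ v ∈ ⋂₀ 𝓡, ∀ w ∈ ⋂₀ 𝓡, v + w ∈ ⋂₀ 𝓡 := by
      intro v hv w hw R hR
      obtain ⟨x, hx, rfl⟩ := hreg' R hR
      intro i
      have h₁ := signVector_mul_nonneg_iff.1 (hv _ hR i)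
      have h₂ := signVector_mul_nonneg_iff.1 (hw _ hR i)
      rw [signVector_mul_nonneg_iff, map_add]
      linarith
    have hzero : (0 : V) ∈ ⋂₀ 𝓡 := by
      intro R hR
      obtain ⟨x, hx, rfl⟩ := hreg' R hR
      intro i
      simp [signVector]
    obtain ⟨_, ⟨v, hv, rfl⟩, hmax⟩ := (Set.toFinite (supp '' ⋂₀ 𝓡)).exists_maximal
      ⟨_, Set.mem_image_of_mem supp hzero⟩
    obtain ⟨x₀, hx₀, rfl⟩ := hreg' R₀ hR₀
    refine ⟨v, subset_antisymm (fun w hw i => ?_) fun w hw R hR => ?_⟩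
    · have key : ∀ x a b : SignType, x ≠ 0 → 0 ≤ x * a → 0 ≤ x * b → (a = 0 → b = 0) →
          b = 0 ∨ b = a := by decide
      refine key _ _ _ (hx₀ i) (hv _ hR₀ i) (hw _ hR₀ i) fun hvi => ?_
      have hsub : supp v ⊆ supp (v + w) := by
        intro j hj
        simp only [supp, Finset.mem_filter, Finset.mem_univ, true_and] at hj ⊢
        intro h0
        have h₁ := signVector_mul_nonneg_iff.1 (hv _ hR₀ j)
        have h₂ := signVector_mul_nonneg_iff.1 (hw _ hR₀ j)
        have h₃ : f j x₀ * f j v ≠ 0 := mul_ne_zero (fun h => hx₀ j (by simp [signVector, h])) hj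
        have h₄ : f j x₀ * (f j v + f j w) = 0 := by rw [← map_add, h0, mul_zero]
        exact h₃ (by linarith)
      have := hmax (Set.mem_image_of_mem supp (hadd v hv w hw)) hsub
      simp only [signVector, sign_eq_zero_iff] at hvi ⊢
      by_contra hwi
      have hmem : i ∈ supp (v + w) := by simp [supp, hvi, hwi]
      have := this hmem
      simp [supp, hvi] at this
    · obtain ⟨x, hx, rfl⟩ := hreg' R hR
      exact closedFace_subset_closedRegion_iff.2 (hv _ hR) hw
  · rintro ⟨v, rfl⟩
    -- Two regions suffice: the ends of the facial interval.
    obtain ⟨x, hx⟩ := exists_signVector_eq_ite (f := f) v b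
    obtain ⟨y, hy⟩ := exists_signVector_eq_ite (f := f) v (-b)
    have hb' : ∀ i, signVector f (-b) i = 1 := fun i => by
      rw [signVector_neg, Pi.neg_apply, hb]; rfl
    simp only [hb] at hx
    simp only [hb'] at hy
    refine ⟨{closedRegion f x, closedRegion f y}, by simp, ?_, ?_⟩
    · have key₁ : ∀ a : SignType, (if a = 0 then -1 else a) ≠ 0 := by decide
      have key₂ : ∀ a : SignType, (if a = 0 then 1 else a) ≠ 0 := by decide
      rintro _ (rfl | rfl)
      · exact hf.isRegion_iff.2 ⟨x, fun i => by rw [hx]; exact key₁ _, rfl⟩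
      · exact hf.isRegion_iff.2 ⟨y, fun i => by rw [hy]; exact key₂ _, rfl⟩
    · ext w
      have key : ∀ a b : SignType, (b = 0 ∨ b = a) ↔
          0 ≤ (if a = 0 then -1 else a) * b ∧ 0 ≤ (if a = 0 then 1 else a) * b := by decide
      simp only [closedFace, closedRegion, Set.mem_ofPred_eq, Set.sInter_insert,
        Set.sInter_singleton, Set.mem_inter_iff, hx, hy, key, forall_and]

/-! ### The facial weak order is the componentwise order of sign vectors -/

/-- Two normal vectors of a hyperplane are proportional. -/
theorem _root_.IsNormalVector.exists_eq_smul {e e' : V} {H : Submodule ℝ V}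
    (he : IsNormalVector e H) (he' : IsNormalVector e' H) : ∃ a : ℝ, a ≠ 0 ∧ e = a • e' := by
  have hee : ⟪e', e'⟫_ℝ ≠ 0 := inner_self_ne_zero.2 he'.1
  set a := ⟪e', e⟫_ℝ / ⟪e', e'⟫_ℝ with ha
  have h₁ : ⟪e', e - a • e'⟫_ℝ = 0 := by
    rw [inner_sub_right, real_inner_smul_right, ha, div_mul_cancel₀ _ hee, sub_self]
  have h₂ : ⟪e, e - a • e'⟫_ℝ = 0 := (he.2 _).1 ((he'.2 _).2 h₁)
  have h₃ : e - a • e' = 0 := by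
    rw [← inner_self_eq_zero (𝕜 := ℝ)]
    nth_rewrite 1 [sub_eq_add_neg]
    rw [inner_add_left, inner_neg_left, real_inner_smul_left, h₁, h₂]
    simp
  refine ⟨a, fun h => he.1 ?_, sub_eq_zero.1 h₃⟩
  rw [sub_eq_zero.1 h₃, h, zero_smul]

/-- A choice of normal vectors of the hyperplanes of an arrangement. -/
def IsNormalFamily (A : HyperplaneArrangement V) (e : A.hyperplanes → V) : Prop :=
  ∀ H : A.hyperplanes, IsNormalVector (e H) H.1

variable {e : A.hyperplanes → V}

theorem IsNormalFamily.isFormFamily (he : A.IsNormalFamily e) :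
    A.IsFormFamily (normalForms e) := fun H v => (he H).2 v

/-- Normal vectors can be chosen on the side opposite to a given point off the hyperplanes. -/
theorem exists_isNormalFamily {b : V} (hb : b ∈ A.complement) :
    ∃ e, A.IsNormalFamily e ∧ ∀ i, signVector (normalForms e) b i = -1 := by
  have h : ∀ H : A.hyperplanes, ∃ e : V, IsNormalVector e H.1 ∧ ⟪e, b⟫_ℝ < 0 := by
    rintro ⟨H, hH⟩
    obtain ⟨e, he⟩ := A.exists_normal H hH
    have hne : ⟪e, b⟫_ℝ ≠ 0 := fun h => hb H hH ((he.2 b).2 h)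
    rcases lt_or_gt_of_ne hne with h | h
    · exact ⟨e, he, h⟩
    · refine ⟨-e, ⟨neg_ne_zero.2 he.1, fun v => ?_⟩, ?_⟩
      · rw [inner_neg_left, neg_eq_zero, he.2]
      · rw [inner_neg_left]; linarith
  choose e he hneg using h
  exact ⟨e, he, fun i => sign_neg (hneg i)⟩

theorem IsNormalFamily.separates_iff (he : A.IsNormalFamily e) {x y : V}
    (hx : ∀ i, signVector (normalForms e) x i ≠ 0)
    (hy : ∀ i, signVector (normalForms e) y i ≠ 0) (i : A.hyperplanes) :
    Separates i.1 (closedRegion (normalForms e) x)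
        (closedRegion (normalForms e) y) ↔
      signVector (normalForms e) x i = -signVector (normalForms e) y i := by
  have hx0 : ⟪e i, x⟫_ℝ ≠ 0 := fun h => hx i (by simp [signVector, h])
  have hy0 : ⟪e i, y⟫_ℝ ≠ 0 := fun h => hy i (by simp [signVector, h])
  have hxx : x ∈ closedRegion (normalForms e) x := fun i =>
    signVector_mul_nonneg_iff.2 (mul_self_nonneg _)
  have hyy : y ∈ closedRegion (normalForms e) y := fun i =>
    signVector_mul_nonneg_iff.2 (mul_self_nonneg _)
  simp only [signVector, innerₗ_apply_apply]
  constructor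
  · rintro ⟨e', he', h₁, h₂⟩
    obtain ⟨a, ha, rfl⟩ := he'.exists_eq_smul (he i)
    have h₁ := h₁ x hxx
    have h₂ := h₂ y hyy
    rw [real_inner_smul_left] at h₁ h₂
    have h₁' := h₁.lt_of_ne' (mul_ne_zero ha hx0)
    have h₂' := h₂.lt_of_ne (mul_ne_zero ha hy0)
    rcases lt_or_gt_of_ne ha with ha | ha
    · rw [sign_neg (neg_of_mul_pos_right h₁' ha.le), sign_pos (pos_of_mul_neg_right h₂' ha.le)]
    · rw [sign_pos (pos_of_mul_pos_right h₁' ha.le), sign_neg (neg_of_mul_neg_right h₂' ha.le),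
        neg_neg]
  · intro h
    rcases lt_or_gt_of_ne hx0 with hx0 | hx0
    · rw [sign_neg hx0, neg_inj, eq_comm, sign_eq_one_iff] at h
      refine ⟨-e i, ⟨neg_ne_zero.2 (he i).1, fun v => ?_⟩, fun v hv => ?_, fun v hv => ?_⟩
      · rw [inner_neg_left, neg_eq_zero, (he i).2]
      · have : 0 ≤ ⟪e i, x⟫_ℝ * ⟪e i, v⟫_ℝ := signVector_mul_nonneg_iff.1 (hv i)
        rw [inner_neg_left]
        nlinarith
      · have : 0 ≤ ⟪e i, y⟫_ℝ * ⟪e i, v⟫_ℝ := signVector_mul_nonneg_iff.1 (hv i)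
        rw [inner_neg_left]
        nlinarith
    · rw [sign_pos hx0, eq_comm, neg_eq_iff_eq_neg, sign_eq_neg_one_iff] at h
      refine ⟨e i, he i, fun v hv => ?_, fun v hv => ?_⟩
      · have : 0 ≤ ⟪e i, x⟫_ℝ * ⟪e i, v⟫_ℝ := signVector_mul_nonneg_iff.1 (hv i)
        nlinarith
      · have : 0 ≤ ⟪e i, y⟫_ℝ * ⟪e i, v⟫_ℝ := signVector_mul_nonneg_iff.1 (hv i)
        nlinarith

/-- The order of the poset of regions is the componentwise order of sign vectors. -/
theorem IsNormalFamily.regionLE_iff (he : A.IsNormalFamily e) {b x y : V} {B R R' : A.Region}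
    (hb : ∀ i, signVector (normalForms e) b i = -1)
    (hx : ∀ i, signVector (normalForms e) x i ≠ 0)
    (hy : ∀ i, signVector (normalForms e) y i ≠ 0)
    (hB : B.1 = closedRegion (normalForms e) b)
    (hR : R.1 = closedRegion (normalForms e) x)
    (hR' : R'.1 = closedRegion (normalForms e) y) :
    A.RegionLE B R R' ↔ signVector (normalForms e) x ≤
      signVector (normalForms e) y := by
  have hb0 : ∀ i, signVector (normalForms e) b i ≠ 0 := fun i => by rw [hb]; decide
  have key : ∀ a c : SignType, a ≠ 0 → c ≠ 0 → ((-1 = -a → -1 = -c) ↔ a ≤ c) := by decide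
  have : A.RegionLE B R R' ↔ ∀ i : A.hyperplanes, Separates i.1 B.1 R.1 → Separates i.1 B.1 R'.1 :=
    ⟨fun h i hi => (h ⟨i.2, hi⟩).2, fun h H hH => ⟨hH.1, h ⟨H, hH.1⟩ hH.2⟩⟩
  rw [this, hB, hR, hR']
  refine forall_congr' fun i => ?_
  rw [he.separates_iff hb0 hx, he.separates_iff hb0 hy, hb]
  exact key _ _ (hx i) (hy i)

/-- The facial interval of a face consists of the regions whose sign vectors are obtained by
replacing the zeros by nonzero signs. -/
theorem IsNormalFamily.isFacialInterval_iff [FiniteDimensional ℝ V] (he : A.IsNormalFamily e)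
    {b v x y : V} {B m M : A.Region} {F : A.Face}
    (hb : ∀ i, signVector (normalForms e) b i = -1)
    (hx : ∀ i, signVector (normalForms e) x i ≠ 0)
    (hy : ∀ i, signVector (normalForms e) y i ≠ 0)
    (hB : B.1 = closedRegion (normalForms e) b)
    (hm : m.1 = closedRegion (normalForms e) x)
    (hM : M.1 = closedRegion (normalForms e) y)
    (hF : F.1 = closedFace (normalForms e) v) :
    A.IsFacialInterval B F m M ↔ ∀ i,
      (signVector (normalForms e) x i =
        if signVector (normalForms e) v i = 0 then -1 else
          signVector (normalForms e) v i) ∧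
      signVector (normalForms e) y i =
        if signVector (normalForms e) v i = 0 then 1 else
          signVector (normalForms e) v i := by
  set f : A.hyperplanes → V →ₗ[ℝ] ℝ := normalForms e
  have hform : A.IsFormFamily f := he.isFormFamily
  have key₀ : ∀ a z : SignType, z ≠ 0 → (0 ≤ z * a ↔
      (if a = 0 then -1 else a) ≤ z ∧ z ≤ (if a = 0 then 1 else a)) := by decide
  have hmem : ∀ R : A.Region, ∀ z, (∀ i, signVector f z i ≠ 0) → R.1 = closedRegion f z →
      (F.1 ⊆ R.1 ↔ ∀ i,
        (if signVector f v i = 0 then -1 else signVector f v i) ≤ signVector f z i ∧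
        signVector f z i ≤ (if signVector f v i = 0 then 1 else signVector f v i)) := by
    intro R z hz hR
    rw [hF, hR, closedFace_subset_closedRegion_iff]
    exact forall_congr' fun i => key₀ _ _ (hz i)
  have hle : ∀ {R R' : A.Region} {z z' : V}, (∀ i, signVector f z i ≠ 0) →
      (∀ i, signVector f z' i ≠ 0) → R.1 = closedRegion f z → R'.1 = closedRegion f z' →
      (A.RegionLE B R R' ↔ signVector f z ≤ signVector f z') := fun hz hz' hR hR' =>
    he.regionLE_iff hb hz hz' hB hR hR'
  constructor
  · -- The interval with the expected ends `m'` and `M'` also consists of the regions that contain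
    -- the face, and the ends of an interval are determined by its elements.
    intro h
    obtain ⟨x', hx'⟩ := exists_signVector_eq_ite (f := f) v b
    obtain ⟨y', hy'⟩ := exists_signVector_eq_ite (f := f) v (-b)
    have hb' : ∀ i, signVector f (-b) i = 1 := fun i => by
      rw [signVector_neg, Pi.neg_apply, hb]; rfl
    simp only [hb] at hx'
    simp only [hb'] at hy'
    have key₁ : ∀ a : SignType, (if a = 0 then -1 else a) ≠ 0 := by decide
    have key₂ : ∀ a : SignType, (if a = 0 then 1 else a) ≠ 0 := by decide
    have key₃ : ∀ a : SignType, (if a = 0 then -1 else a) ≤ (if a = 0 then 1 else a) := by decide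
    have hx'0 : ∀ i, signVector f x' i ≠ 0 := fun i => by rw [hx']; exact key₁ _
    have hy'0 : ∀ i, signVector f y' i ≠ 0 := fun i => by rw [hy']; exact key₂ _
    let m' : A.Region := ⟨closedRegion f x', hform.isRegion_iff.2 ⟨x', hx'0, rfl⟩⟩
    let M' : A.Region := ⟨closedRegion f y', hform.isRegion_iff.2 ⟨y', hy'0, rfl⟩⟩
    have h₁ := (h.2 m').1 ((hmem m' x' hx'0 rfl).2 fun i => by
      rw [hx' i]; exact ⟨le_rfl, key₃ _⟩)
    have h₂ := (h.2 M').1 ((hmem M' y' hy'0 rfl).2 fun i => by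
      rw [hy' i]; exact ⟨key₃ _, le_rfl⟩)
    have h₃ := (hmem m x hx hm).1 ((h.2 m).2 ⟨subset_rfl, h.1⟩)
    have h₄ := (hmem M y hy hM).1 ((h.2 M).2 ⟨h.1, subset_rfl⟩)
    intro i
    exact ⟨le_antisymm (((hle hx hx'0 hm rfl).1 h₁.1 i).trans (hx' i).le) (h₃ i).1,
      le_antisymm (h₄ i).2 ((hy' i).ge.trans ((hle hy'0 hy rfl hM).1 h₂.2 i))⟩
  · intro h
    have key₃ : ∀ a : SignType, (if a = 0 then -1 else a) ≤ (if a = 0 then 1 else a) := by decide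
    refine ⟨(hle hx hy hm hM).2 fun i => ?_, fun R => ?_⟩
    · rw [(h i).1, (h i).2]; exact key₃ _
    · obtain ⟨z, hz, hR⟩ := hform.isRegion_iff.1 R.2
      rw [hmem R z hz hR, hle hx hz hm hR, hle hz hy hR hM, Pi.le_def, Pi.le_def, ← forall_and]
      refine forall_congr' fun i => ?_
      rw [(h i).1, (h i).2]

theorem IsNormalFamily.facialWeakLE_iff [FiniteDimensional ℝ V] (he : A.IsNormalFamily e)
    {b v w : V} {B : A.Region} {F G : A.Face}
    (hb : ∀ i, signVector (normalForms e) b i = -1)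
    (hB : B.1 = closedRegion (normalForms e) b)
    (hF : F.1 = closedFace (normalForms e) v)
    (hG : G.1 = closedFace (normalForms e) w) :
    A.FacialWeakLE B F G ↔ signVector (normalForms e) v ≤
      signVector (normalForms e) w := by
  have hform := he.isFormFamily
  constructor
  · rintro ⟨mF, MF, mG, MG, h₁, h₂, h₃, h₄⟩
    obtain ⟨x, hx, hmF⟩ := hform.isRegion_iff.1 mF.2
    obtain ⟨y, hy, hMF⟩ := hform.isRegion_iff.1 MF.2
    obtain ⟨x', hx', hmG⟩ := hform.isRegion_iff.1 mG.2
    obtain ⟨y', hy', hMG⟩ := hform.isRegion_iff.1 MG.2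
    rw [he.isFacialInterval_iff hb hx hy hB hmF hMF hF] at h₁
    rw [he.isFacialInterval_iff hb hx' hy' hB hmG hMG hG] at h₂
    rw [he.regionLE_iff hb hx hx' hB hmF hmG] at h₃
    rw [he.regionLE_iff hb hy hy' hB hMF hMG] at h₄
    intro i
    have key : ∀ a c : SignType, (if a = 0 then -1 else a) ≤ (if c = 0 then -1 else c) →
        (if a = 0 then 1 else a) ≤ (if c = 0 then 1 else c) → a ≤ c := by decide
    have h₃ := h₃ i
    have h₄ := h₄ i
    rw [(h₁ i).1, (h₂ i).1] at h₃
    rw [(h₁ i).2, (h₂ i).2] at h₄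
    exact key _ _ h₃ h₄
  · intro h
    have hb' : ∀ i, signVector (normalForms e) (-b) i = 1 := fun i => by
      rw [signVector_neg, Pi.neg_apply, hb]; rfl
    have key₁ : ∀ a : SignType, (if a = 0 then -1 else a) ≠ 0 := by decide
    have key₂ : ∀ a : SignType, (if a = 0 then 1 else a) ≠ 0 := by decide
    have hends : ∀ v, ∃ x y, (∀ i, signVector (normalForms e) x i ≠ 0) ∧
        (∀ i, signVector (normalForms e) y i ≠ 0) ∧ ∀ i,
        (signVector (normalForms e) x i =
          if signVector (normalForms e) v i = 0 then -1 else
            signVector (normalForms e) v i) ∧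
        signVector (normalForms e) y i =
          if signVector (normalForms e) v i = 0 then 1 else
            signVector (normalForms e) v i := by
      intro v
      obtain ⟨x, hx⟩ := exists_signVector_eq_ite (f := normalForms e) v b
      obtain ⟨y, hy⟩ := exists_signVector_eq_ite (f := normalForms e) v (-b)
      simp only [hb] at hx
      simp only [hb'] at hy
      exact ⟨x, y, fun i => by rw [hx]; exact key₁ _, fun i => by rw [hy]; exact key₂ _,
        fun i => ⟨hx i, hy i⟩⟩
    obtain ⟨x, y, hx, hy, hxy⟩ := hends v
    obtain ⟨x', y', hx', hy', hxy'⟩ := hends w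
    refine ⟨⟨_, hform.isRegion_iff.2 ⟨x, hx, rfl⟩⟩, ⟨_, hform.isRegion_iff.2 ⟨y, hy, rfl⟩⟩,
      ⟨_, hform.isRegion_iff.2 ⟨x', hx', rfl⟩⟩, ⟨_, hform.isRegion_iff.2 ⟨y', hy', rfl⟩⟩,
      (he.isFacialInterval_iff hb hx hy hB rfl rfl hF).2 hxy,
      (he.isFacialInterval_iff hb hx' hy' hB rfl rfl hG).2 hxy',
      (he.regionLE_iff hb hx hx' hB rfl rfl).2 fun i => ?_,
      (he.regionLE_iff hb hy hy' hB rfl rfl).2 fun i => ?_⟩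
    · rw [(hxy i).1, (hxy' i).1]
      have key : ∀ a c : SignType, a ≤ c →
        (if a = 0 then -1 else a) ≤ (if c = 0 then -1 else c) := by decide
      exact key _ _ (h i)
    · rw [(hxy i).2, (hxy' i).2]
      have key : ∀ a c : SignType, a ≤ c →
        (if a = 0 then 1 else a) ≤ (if c = 0 then 1 else c) := by decide
      exact key _ _ (h i)

end HyperplaneArrangement

namespace HyperplaneArrangement

variable {V : Type*} [NormedAddCommGroup V] [InnerProductSpace ℝ V]
  {A : HyperplaneArrangement V} {e : A.hyperplanes → V}

/-! ### Simplicial charts of a simplicial arrangement -/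

/-- A linearly independent family has a family of dual vectors. -/
theorem _root_.LinearIndependent.exists_dual_vectors [FiniteDimensional ℝ V] {κ : Type*}
    {w : κ → V} (hw : LinearIndependent ℝ w) :
    ∃ d : κ → V, (∀ k, ⟪w k, d k⟫_ℝ = 1) ∧ ∀ k l, k ≠ l → ⟪w k, d l⟫_ℝ = 0 := by
  classical
  obtain ⟨g, hg⟩ := (Finsupp.linearCombination ℝ w).exists_leftInverse_of_injective
    (LinearMap.ker_eq_bot.2 hw)
  have hgw : ∀ k, g (w k) = Finsupp.single k 1 := fun k => by
    have := LinearMap.congr_fun hg (Finsupp.single k 1)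
    simpa using this
  refine ⟨fun l => (InnerProductSpace.toDual ℝ V).symm
    (LinearMap.toContinuousLinearMap (Finsupp.lapply l ∘ₗ g)), fun k => ?_, fun k l hkl => ?_⟩
  · rw [real_inner_comm, InnerProductSpace.toDual_symm_apply]
    simp [hgw]
  · rw [real_inner_comm, InnerProductSpace.toDual_symm_apply]
    simp [hgw, hkl]

/-- A hyperplane that contains a relatively open piece of a region is a wall of it. -/
theorem IsNormalFamily.isWall_of_forall_exists [FiniteDimensional ℝ V] (he : A.IsNormalFamily e)
    {R : A.Region} {i : A.hyperplanes} {q : V} (hqi : q ∈ i.1) (hqR : q ∈ R.1)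
    (hq : ∀ h ∈ i.1, ∃ t : ℝ, 0 < t ∧ q + t • h ∈ R.1) : A.IsWall R i.1 := by
  refine ⟨i.2, ?_⟩
  have hspan : vectorSpan ℝ ((i.1 : Set V) ∩ R.1) = i.1 := by
    apply le_antisymm
    · rw [vectorSpan_def, Submodule.span_le]
      rintro _ ⟨x, hx, y, hy, rfl⟩
      exact i.1.sub_mem hx.1 hy.1
    · intro h hh
      obtain ⟨t, ht, htR⟩ := hq h hh
      have hmem : q + t • h ∈ (i.1 : Set V) ∩ R.1 :=
        ⟨i.1.add_mem hqi (i.1.smul_mem t hh), htR⟩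
      have := vsub_mem_vectorSpan ℝ hmem ⟨hqi, hqR⟩
      rw [vsub_eq_sub, add_sub_cancel_left] at this
      exact (Submodule.smul_mem_iff _ ht.ne').1 this
  have horth : i.1 = (ℝ ∙ e i)ᗮ := by
    ext v
    rw [(he i).2, Submodule.mem_orthogonal_singleton_iff_inner_right]
  have := Submodule.finrank_add_finrank_orthogonal (ℝ ∙ e i)
  rw [hspan, ← this, finrank_span_singleton (he i).1, ← horth, add_comm]

/-- A minimal set of hyperplanes that cut out a region consists of walls of the region. For a
simplicial region, their normals are linearly independent and so have dual vectors. -/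
theorem IsNormalFamily.exists_walls_dual [FiniteDimensional ℝ V] (he : A.IsNormalFamily e)
    (hA : A.IsSimplicial) {x : V} {s : A.hyperplanes → ℝ} (hs : ∀ i, s i = 1 ∨ s i = -1)
    (hsx : ∀ i, 0 < s i * normalForms e i x) :
    ∃ (W : Finset A.hyperplanes) (d : A.hyperplanes → V),
      (∀ u, (∀ k ∈ W, 0 ≤ s k * normalForms e k u) → ∀ i, 0 ≤ s i * normalForms e i u) ∧
      (∀ k ∈ W, s k * normalForms e k (d k) = 1) ∧
      ∀ k ∈ W, ∀ l ∈ W, k ≠ l → normalForms e k (d l) = 0 := by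
  classical
  set f := normalForms e with hf
  have hform : A.IsFormFamily f := he.isFormFamily
  have hs0 : ∀ i, s i ≠ 0 := fun i h => by simpa [h] using hsx i
  have hx0 : ∀ i, signVector f x i ≠ 0 := fun i h => by
    have := hsx i
    rw [sign_eq_zero_iff.1 h, mul_zero] at this
    exact this.false
  let R : A.Region := ⟨closedRegion f x, hform.isRegion_iff.2 ⟨x, hx0, rfl⟩⟩
  have hR : ∀ u, (∀ i, 0 ≤ s i * f i u) → u ∈ R.1 := fun u hu i => by
    refine signVector_mul_nonneg_iff.2 ?_
    have h₁ := hsx i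
    have h₂ := hu i
    rcases hs i with h | h <;> rw [h] at h₁ h₂ <;> nlinarith
  obtain ⟨W, hW, hmin⟩ := (Set.toFinite {W : Finset A.hyperplanes |
    ∀ u, (∀ k ∈ W, 0 ≤ s k * f k u) → ∀ i, 0 ≤ s i * f i u}).exists_minimal
    ⟨Finset.univ, fun u hu i => hu i (Finset.mem_univ i)⟩
  have hwall : ∀ k ∈ W, A.IsWall R k.1 := by
    intro k hk
    -- By minimality, some point `u` violates the inequality of `k` only. The segment from `u` to
    -- `x` meets the hyperplane in a relatively interior point of a facet.
    obtain ⟨u, hu, hku⟩ : ∃ u, (∀ l ∈ W, l ≠ k → 0 ≤ s l * f l u) ∧ s k * f k u < 0 := by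
      by_contra! h
      refine (Finset.erase_ssubset hk).not_ge (hmin (fun u hu => hW u fun l hl => ?_)
        (Finset.erase_subset k W))
      have hu' : ∀ l ∈ W, l ≠ k → 0 ≤ s l * f l u := fun l hl hlk =>
        hu l (Finset.mem_erase.2 ⟨hlk, hl⟩)
      by_cases hlk : l = k
      · rw [hlk]; exact h u hu'
      · exact hu' l hl hlk
    let q := (s k * f k x) • u + (-(s k * f k u)) • x
    have hqk : f k q = 0 := by
      simp only [q, map_add, map_smul, smul_eq_mul]; ring
    have hql : ∀ l ∈ W, l ≠ k → 0 < s l * f l q := fun l hl hlk => by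
      have : s l * f l q =
          (s k * f k x) * (s l * f l u) + (-(s k * f k u)) * (s l * f l x) := by
        simp only [q, map_add, map_smul, smul_eq_mul]; ring
      rw [this]
      exact add_pos_of_nonneg_of_pos (mul_nonneg (hsx k).le (hu l hl hlk))
        (mul_pos (by linarith) (hsx l))
    refine he.isWall_of_forall_exists (q := q) ((hform k q).2 hqk) (hR q (hW q fun l hl => ?_))
      fun h hh => ?_
    · by_cases hlk : l = k
      · rw [hlk, hqk, mul_zero]
      · exact (hql l hl hlk).le
    · have hhk : f k h = 0 := (hform k h).1 hh
      have hev : ∀ᶠ t : ℝ in nhdsWithin 0 (Set.Ioi 0), ∀ l, l ∈ W → l ≠ k →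
          0 < s l * f l q + t * (s l * f l h) := by
        rw [Filter.eventually_all]
        intro l
        by_cases hl : l ∈ W ∧ l ≠ k
        · have hcont : Filter.Tendsto (fun t : ℝ => s l * f l q + t * (s l * f l h))
              (nhdsWithin 0 (Set.Ioi 0)) (nhds (s l * f l q + 0 * (s l * f l h))) :=
            ((by fun_prop : Continuous fun t : ℝ =>
              s l * f l q + t * (s l * f l h)).tendsto 0).mono_left nhdsWithin_le_nhds
          have hpos : 0 < s l * f l q + 0 * (s l * f l h) := by
            rw [zero_mul, add_zero]; exact hql l hl.1 hl.2
          filter_upwards [hcont.eventually_const_lt hpos] with t ht _ _ using ht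
        · exact Filter.Eventually.of_forall fun t h₁ h₂ => absurd ⟨h₁, h₂⟩ hl
      obtain ⟨t, ht, ht0⟩ := (hev.and self_mem_nhdsWithin).exists
      refine ⟨t, ht0, hR _ (hW _ fun l hl => ?_)⟩
      by_cases hlk : l = k
      · rw [hlk, map_add, map_smul, hqk, hhk]; simp
      · have := (ht l hl hlk).le
        simp only [map_add, map_smul, smul_eq_mul]
        linarith
  obtain ⟨e', he', hli⟩ := hA R
  let g : {k // k ∈ W} → {H : Submodule ℝ V // A.IsWall R H} := fun k => ⟨k.1.1, hwall k.1 k.2⟩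
  have hg : Function.Injective g := fun k l hkl => by
    have hkl' : k.1.1 = l.1.1 := congrArg (fun H => H.1) hkl
    exact Subtype.ext (Subtype.ext hkl')
  obtain ⟨d, hd₁, hd₂⟩ := (hli.comp g hg).exists_dual_vectors
  have hpar : ∀ k : {k // k ∈ W}, ∃ a : ℝ, a ≠ 0 ∧ e k.1 = a • e' (g k) := fun k =>
    (he k.1).exists_eq_smul (he' (g k))
  choose a ha hea using hpar
  refine ⟨W, fun l => if hl : l ∈ W then (s l * a ⟨l, hl⟩)⁻¹ • d ⟨l, hl⟩ else 0, hW,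
    fun k hk => ?_, fun k hk l hl hkl => ?_⟩
  · have h₁ : f k (d ⟨k, hk⟩) = a ⟨k, hk⟩ := by
      have := hd₁ ⟨k, hk⟩
      simp only [Function.comp_apply] at this
      rw [hf, normalForms, innerₗ_apply_apply, hea ⟨k, hk⟩, real_inner_smul_left, this, mul_one]
    simp only [dif_pos hk, map_smul, smul_eq_mul, h₁]
    have := hs0 k
    have := ha ⟨k, hk⟩
    field_simp
  · have h₁ : f k (d ⟨l, hl⟩) = 0 := by
      have := hd₂ ⟨k, hk⟩ ⟨l, hl⟩ (fun h => hkl (congrArg Subtype.val h))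
      simp only [Function.comp_apply] at this
      rw [hf, normalForms, innerₗ_apply_apply, hea ⟨k, hk⟩, real_inner_smul_left, this, mul_zero]
    simp only [dif_pos hl, map_smul, h₁, smul_zero]

/-- The chart at `v` comes from the region of `v + ε • b` for small `ε > 0`. -/
theorem IsNormalFamily.nonempty_simplicialChart [FiniteDimensional ℝ V] (he : A.IsNormalFamily e)
    (hA : A.IsSimplicial) {b : V} (hb : ∀ i, signVector (normalForms e) b i = -1) (v : V) :
    Nonempty (SimplicialChart (normalForms e) v) := by
  classical
  set f := normalForms e
  obtain ⟨x, hx⟩ := exists_signVector_eq_ite (f := f) v b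
  simp only [hb] at hx
  have hx0 : ∀ i, f i x ≠ 0 := fun i h => by
    have key : ∀ a : SignType, (if a = 0 then -1 else a) ≠ 0 := by decide
    exact key _ ((hx i).symm.trans (sign_eq_zero_iff.2 h))
  let s : A.hyperplanes → ℝ := fun i => if 0 < f i x then 1 else -1
  have hs : ∀ i, s i = 1 ∨ s i = -1 := fun i => by
    simp only [s]; split_ifs <;> simp
  have hsx : ∀ i, 0 < s i * f i x := fun i => by
    simp only [s]
    split_ifs with h
    · linarith
    · have := (not_lt.1 h).lt_of_ne (hx0 i); linarith
  obtain ⟨W, d, hW, hd₁, hd₂⟩ := he.exists_walls_dual hA hs hsx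
  have hss : ∀ i, s i * s i = 1 := fun i => by rcases hs i with h | h <;> simp [h]
  have hnonneg : ∀ i, 0 ≤ s i * f i v := fun i => by
    by_cases hi : f i v = 0
    · simp [hi]
    have h₁ : SignType.sign (f i x) = SignType.sign (f i v) := by
      have := hx i
      rwa [if_neg (by simpa [signVector] using hi)] at this
    have h₂ := hsx i
    rw [← sign_eq_one_iff, sign_mul, h₁, ← sign_mul, sign_eq_one_iff] at h₂
    exact h₂.le
  have hs_zero : ∀ i, f i v = 0 → s i = -1 := fun i hi => by
    have := hx i
    rw [if_pos (by simp [signVector, hi])] at this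
    exact if_neg (sign_eq_neg_one_iff.1 this).not_gt
  -- Subtracting from `u` its coordinate part leaves a vector on which all forms vanish, since
  -- both it and its negative satisfy the inequalities that define the region.
  have hexp : ∀ i u, s i * f i u = ∑ k ∈ W, (s i * f i (d k)) * (s k * f k u) := by
    intro i u
    let u' := u - ∑ k ∈ W, (s k * f k u) • d k
    have hu' : ∀ l ∈ W, s l * f l u' = 0 := by
      intro l hl
      have : ∑ k ∈ W, (s k * f k u) * f l (d k) = (s l * f l u) * f l (d l) :=
        Finset.sum_eq_single_of_mem l hl fun k hk hkl => by
          rw [hd₂ l hl k hk hkl.symm, mul_zero]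
      simp only [u', map_sub, map_sum, map_smul, smul_eq_mul, this]
      linear_combination -(s l * f l u) * hd₁ l hl
    have h₁ := hW u' (fun l hl => (hu' l hl).ge) i
    have h₂ := hW (-u') (fun l hl => by rw [map_neg, mul_neg, hu' l hl, neg_zero]) i
    rw [map_neg, mul_neg] at h₂
    have h₃ : s i * f i u' = 0 := le_antisymm (by linarith) h₁
    simp only [u', map_sub, map_sum, map_smul, smul_eq_mul, mul_sub] at h₃
    rw [sub_eq_zero.1 h₃, Finset.mul_sum]
    exact Finset.sum_congr rfl fun k _ => by ring
  have hc : ∀ i, ∀ k ∈ W, 0 ≤ s i * f i (d k) := fun i k hk => hW (d k) (fun l hl => by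
    by_cases hlk : l = k
    · rw [hlk, hd₁ k hk]; exact zero_le_one
    · rw [hd₂ l hl k hk hlk, mul_zero]) i
  have hev : ∀ᶠ ε : ℝ in nhdsWithin 0 (Set.Ioi 0), ∀ i k,
      0 < (s i * f i (d k)) * (s k * f k v) →
        ε * ∑ l ∈ W, s i * f i (d l) < (s i * f i (d k)) * (s k * f k v) := by
    simp only [Filter.eventually_all]
    intro i k hpos
    have hcont : Filter.Tendsto (fun ε : ℝ => ε * ∑ l ∈ W, s i * f i (d l))
        (nhdsWithin 0 (Set.Ioi 0)) (nhds (0 * ∑ l ∈ W, s i * f i (d l))) :=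
      (Filter.tendsto_id.mul_const _).mono_left nhdsWithin_le_nhds
    rw [zero_mul] at hcont
    exact hcont.eventually_lt_const hpos
  obtain ⟨ε, hε, hε0⟩ := (hev.and self_mem_nhdsWithin).exists
  exact ⟨{
    W := W
    s := s
    c := fun i k => s i * f i (d k)
    d := d
    ε := ε
    s_eq := hs
    c_nonneg := hc
    expand := hexp
    dual_self := hd₁
    dual_of_ne := hd₂
    nonneg := hnonneg
    s_of_eq_zero := hs_zero
    ε_pos := hε0
    ε_lt := fun i k _ => hε i k }⟩

end HyperplaneArrangement

/-! ### The facial weak order -/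

theorem mainTheorem5 {V : Type*} [NormedAddCommGroup V] [InnerProductSpace ℝ V]
    [FiniteDimensional ℝ V] (A : HyperplaneArrangement V) (hA : A.IsSimplicial)
    (B : A.Region) :
    ∃ L : Lattice A.Face,
      (∀ F G : A.Face, L.le F G ↔ A.FacialWeakLE B F G) ∧ @IsSemidistributive A.Face L := by
  obtain ⟨b, hbA, hB⟩ := B.2
  obtain ⟨e, he, hb⟩ := HyperplaneArrangement.exists_isNormalFamily hbA
  have hform := he.isFormFamily
  rw [hform.closure_connectedComponentIn hbA] at hB
  have hdistinct : ∀ i j : A.hyperplanes,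
      (∀ u, normalForms e i u = 0 ↔ normalForms e j u = 0) → i = j := fun i j h =>
    Subtype.ext (SetLike.ext fun u => by rw [hform i u, hform j u, h u])
  obtain ⟨L, hL, hsd⟩ := exists_isSemidistributive_signVector
    (fun i => sign_eq_neg_one_iff.1 (hb i)) hdistinct (he.nonempty_simplicialChart hA hb)
  have hrep : ∀ F : A.Face, ∃ v, F.1 = closedFace (normalForms e) v := fun F =>
    (hform.isFace_iff hb).1 F.2
  choose rep hrep using hrep
  let φ : A.Face → Set.range (signVector (normalForms e)) := fun F => ⟨_, ⟨rep F, rfl⟩⟩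
  have hφ : Function.Bijective φ := by
    refine ⟨fun F G h => Subtype.ext ?_, ?_⟩
    · rw [hrep F, hrep G]
      exact closedFace_eq_iff.2 (congrArg Subtype.val h)
    · rintro ⟨_, v, rfl⟩
      let F : A.Face := ⟨closedFace (normalForms e) v, (hform.isFace_iff hb).2 ⟨v, rfl⟩⟩
      exact ⟨F, Subtype.ext (closedFace_eq_iff.1 (hrep F).symm)⟩
  obtain ⟨L', hL', hsd'⟩ := hsd.exists_lattice_of_equiv (Equiv.ofBijective φ hφ)
  refine ⟨L', fun F G => ?_, hsd'⟩
  rw [hL', he.facialWeakLE_iff hb hB (hrep F) (hrep G)]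
  exact hL _ _
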